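/- Let $k=p+m+1$, let $n\ge k+1$ and $N=k(n-k)$. For a complex $k\times n$ matrix $C$ write $(i_1\dots i_k)$ for the minor of $C$ on the columns $i_1,\dots,i_k$ in this order. Let $B(a,b;\alpha)=1+\alpha E_{ab}$ be the BCFW bridge matrix, so that $\widehat C=C\,B(a,b;\alpha)$ arises from $C$ by $\mathbf b\mapsto\widehat{\mathbf b}=\mathbf b+\alpha\mathbf a$. Here $a\neq b$ are any two columns; they need not be adjacent. **Contour.** A linear relation $(j_1,\dots,j_s)^r$ says that the columns $j_1,\dots,j_s$ span a space of dimension at most $r$ (vanishing of minors). Let $\Gamma$ be the locus of the full-rank matrices satisfying a finite set of linear relations that contains $(b,c_1,\dots,c_s)^m$ with $a,b\notin\{c_1,\dots,c_s\}$. Assume that every relation in the set that contains $b$ but not $a$ contains all of $b,c_1,\dots,c_s$. The *constraint update* replaces each relation $(b,d_1,\dots,d_l)^r$ not containing $a$ by the two relations $(a,b,d_1,\dots,d_l)^{r+1}$ and $(d_1,\dots,d_l)^r$, and keeps all other relations; in particular $(b,c_1,\dots,c_s)^m\to(a,b,c_1,\dots,c_s)^{m+1},\ (c_1,\dots,c_s)^m$.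 Let $\widehat\Gamma$ be the locus of the updated relations. Fix further columns $a_2,\dots,a_{k-m}$, all different from $b$, and work where $(a,a_2\dots a_{k-m},c_1\dots c_m)\neq0$. (The gauge in which this minor is $1$ is the one in which the columns $a,a_2,\dots,a_{k-m},c_1,\dots,c_m$ form the identity matrix.) Put $$t_{1,b}(C)=\frac{(b,a_2\dots a_{k-m},c_1\dots c_m)}{(a,a_2\dots a_{k-m},c_1\dots c_m)} .$$ **Integrand.** Let $f(C)$ be a rational function of the minors of $C$, homogeneous of degree $n$ in them (so that $f(tC)=t^{kn}f(C)$), and let $\overline f=f/(b,a_2\dots a_{k-m},c_1\dots c_m)$ (that is, $\overline f=f/t_{1,b}$ in the gauge above), a rational function of the minors which is homogeneous of degree $n-1$. Assume that the pole of $1/f$ along $t_{1,b}=0$ is simple: a representation of $\overline f$ as a quotient of homogeneous polynomials in the minors has numerator and denominator both nonzero at some point with $t_{1,b}=0$. **Top-form.** Let $z=(z_1,\dots,z_N)\mapsto G(z)$ be a holomorphic, nondegenerate local parametrization of the Grassmannian $G(k,n)$ by $k\times n$ matrices, in which $(a,a_2\dots c_m)\ne0$, in which $\Gamma$ is given by $z_i=0$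 $(i\in A)$, and one of whose coordinates $z_{i_0}$, $i_0\in A$, is $t_{1,b}$. For a function $\varphi$ of $C$ with values in a complex Banach space (in the role of the delta functions $\delta(C)$) let $$\mathcal T_{\Gamma,f}[\varphi]=\oint_{\Gamma}\frac{d^{k\times n}C}{\mathrm{vol}(GL(k))}\,\frac{\varphi(C)}{f(C)}$$ be the integral in which each $z_i$, $i\in A$, runs over a circle around $0$ (with the factor $1/2\pi i$) and every other coordinate runs over a $C^1$ path, and in which the radius $\varepsilon$ of the circle of $z_{i_0}=t_{1,b}$ is small. Attaching the bridge gives $$\widehat{\mathcal T}[\varphi]=\int\frac{d\alpha}{\alpha}\;\mathcal T_{\Gamma,f}\bigl[C\mapsto\varphi(C\,B(a,b;\alpha))\bigr],$$ where $\alpha$ runs over a $C^1$ path in $\mathbb C\setminus\{0\}$. **Claim.** 1. Where $(a,a_2\dots a_{k-m},c_1\dots c_m)\ne0$, $\widehat\Gamma$ is exactly the set of the matrices $C\,B(a,b;\alpha)$ with $C\in\Gamma$ and $\alpha\in\mathbb C$. 2. For such $C$ and $\widehat C=C\,B(a,b;\alpha)$, $$\alpha=\frac{(\widehat b,a_2\dots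 a_{k-m},c_1\dots c_m)}{(a,a_2\dots a_{k-m},c_1\dots c_m)},$$ and the minors of $C$ are obtained from those of $\widehat C$ by $(b\cdots)=(\widehat b\cdots)-\alpha\,(a\cdots)$; the minors without $b$ are unchanged. 3. Let $\overline f(\widehat C)$ denote the value of $\overline f$ (at $t_{1,b}=0$) after this rewriting of the minors, with $\alpha$ the above ratio of minors of $\widehat C$. Then $\widehat f(\widehat C)=(\widehat b,a_2\dots a_{k-m},c_1\dots c_m)\,\overline f(\widehat C)$ is again a rational function of the minors of $\widehat C$, homogeneous of degree $n$. 4. The map $\widehat G(z)=G(z|_{z_{i_0}=0})\,B(a,b;z_{i_0})$ is a holomorphic nondegenerate local parametrization of the Grassmannian in which $\widehat\Gamma$ is given by $z_i=0$ $(i\in A\setminus\{i_0\})$. Suppose that the contour at $t_{1,b}=0$ lies in the domain of the parametrization and that the numerator of $\overline f$ does not vanish on it, and that $\varphi$ is holomorphic near the image of this contour under the bridge. Then for all sufficiently small $\varepsilon>0$ the integrals over the contours converge absolutely, and $$\widehat{\mathcal T}[\varphi]=\oint_{\widehat\Gamma}\frac{d^{k\times n}\widehat C}{\mathrm{vol}(GL(k))}\;\frac{\varphi(\widehat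 C)}{(\widehat b,a_2\dots a_{k-m},c_1\dots c_m)\;\overline f(\widehat C)},$$ where on the right the coordinate $z_{i_0}=\alpha$ runs over the path of $\alpha$ and all other coordinates run over the same paths as before. -/

import Mathlib

noncomputable section

namespace TopForm

/-- The minor `(I₁ … I_k)` of a `k × n` matrix: the determinant of the columns `I₁, …, I_k`,
in this order. -/
def minor {k n : ℕ} (C : Matrix (Fin k) (Fin n) ℂ) (I : Fin k → Fin n) : ℂ :=
  (C.submatrix id I).det

/-- The bridge matrix `B(a, b; α) = 1 + α E_{ab}`; the product `C * bridge a b α` is obtained from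
`C` by replacing the column `b` by `b + α a`. -/
def bridge {n : ℕ} (a b : Fin n) (α : ℂ) : Matrix (Fin n) (Fin n) ℂ :=
  1 + Matrix.single a b α

/-! ### Linear relations and the loci they define -/

/-- A linear relation `(j₁, …, j_s)^r`: the columns `j₁, …, j_s` span a space of dimension at
most `r`. -/
abbrev LinRel (n : ℕ) : Type := Finset (Fin n) × ℕ

/-- The locus (in the space of `k × n` matrices of full rank) cut out by a finite set of linear
relations among the columns. -/
def locus (k : ℕ) {n : ℕ} (L : Finset (LinRel n)) : Set (Matrix (Fin k) (Fin n) ℂ) :=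
  {C | C.rank = k ∧ ∀ R ∈ L, (C.submatrix id (fun j : {j // j ∈ R.1} => j.1)).rank ≤ R.2}

/-- The update of one linear relation when the bridge `(a, b)` is attached:
`(b, c₁, …, c_s)^m` is replaced by `(a, b, c₁, …, c_s)^(m+1)` and `(c₁, …, c_s)^m`;
relations that contain both `a` and `b`, or that do not contain `b`, are kept. -/
def updateRel {n : ℕ} (a b : Fin n) (R : LinRel n) : Finset (LinRel n) :=
  if b ∈ R.1 ∧ a ∉ R.1 then {(insert a R.1, R.2 + 1), (R.1.erase b, R.2)} else {R}

/-- The constraint update of a finite set of linear relations. -/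
def updateRels {n : ℕ} (a b : Fin n) (L : Finset (LinRel n)) : Finset (LinRel n) :=
  L.biUnion (updateRel a b)

/-! ### Functions of the minors -/

/-- A rational function of the minors of a `k × n` matrix which is homogeneous of degree `w` in the
minors.  The integrand `1 / f` of a top-form has `w = n`, so that `f (t C) = t ^ (k * n) f (C)`. -/
structure MinorFun (k n w : ℕ) where
  num : MvPolynomial (Fin k → Fin n) ℂ
  den : MvPolynomial (Fin k → Fin n) ℂ
  deg : ℕ
  num_hom : num.IsHomogeneous (deg + w)
  den_hom : den.IsHomogeneous deg
  num_ne : ∃ C : Matrix (Fin k) (Fin n) ℂ, MvPolynomial.eval (minor C) num ≠ 0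
  den_ne : ∃ C : Matrix (Fin k) (Fin n) ℂ, MvPolynomial.eval (minor C) den ≠ 0

/-- The value of a function of the minors, when the value `x I` is substituted for the
minor `I`. -/
def MinorFun.subst {k n w : ℕ} (f : MinorFun k n w) (x : (Fin k → Fin n) → ℂ) : ℂ :=
  MvPolynomial.eval x f.num / MvPolynomial.eval x f.den

/-- The value of a function of the minors at a matrix. -/
def MinorFun.val {k n w : ℕ} (f : MinorFun k n w) (C : Matrix (Fin k) (Fin n) ℂ) : ℂ :=
  f.subst (minor C)

/-- The column sequence `(x, a₂, …, a_{k-m}, c₁, …, c_m)`, with `k = p + m + 1`. -/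
def cols {p m n : ℕ} (x : Fin n) (a' : Fin p → Fin n) (c : Fin m → Fin n) :
    Fin (p + m + 1) → Fin n :=
  Fin.cons x (Fin.append a' c)

/-- The bridge parameter `α = (b, a₂, …, c_m) / (a, a₂, …, c_m)` as a ratio of minors. -/
def bridgeParam {p m n : ℕ} (a b : Fin n) (a' : Fin p → Fin n) (c : Fin m → Fin n)
    (C : Matrix (Fin (p + m + 1)) (Fin n) ℂ) : ℂ :=
  minor C (cols b a' c) / minor C (cols a a' c)

/-- The rewriting `(b …) = (b̂ …) - α (a …)` of the minors that contain the column `b`; the other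
minors are unchanged.  Here `(a …)` is the minor in which `b` is replaced by `a`. -/
def rewriteMinor {k n : ℕ} (a b : Fin n) (α : ℂ) (C : Matrix (Fin k) (Fin n) ℂ)
    (I : Fin k → Fin n) : ℂ :=
  if ∃ i, I i = b then minor C I - α * minor C (fun i => if I i = b then a else I i)
  else minor C I

/-- The function `(b̂, a₂, …, c_m) · f̄(Ĉ)` whose inverse is the integrand after the bridge has been
attached. -/
def bridgedFun {p m n w : ℕ} (a b : Fin n) (a' : Fin p → Fin n) (c : Fin m → Fin n)
    (fbar : MinorFun (p + m + 1) n w) (C : Matrix (Fin (p + m + 1)) (Fin n) ℂ) : ℂ :=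
  minor C (cols b a' c) * fbar.subst (rewriteMinor a b (bridgeParam a b a' c C) C)

/-! ### The measure, parametrizations of a neighbourhood of the contour, and the top-form -/

/-- The form `d^{k × n} C / vol(GL(k))` at `C`, evaluated on the tangent vectors `v`: the volume
form on the space of `k × n` matrices, contracted with the generators `C ↦ E_{ij} C` of the action
of `GL(k)`.  Here `N = k (n - k)` is the dimension of the Grassmannian. -/
def grassmannForm {k n N : ℕ} (hN : k * k + N = k * n) (C : Matrix (Fin k) (Fin n) ℂ)
    (v : Fin N → Matrix (Fin k) (Fin n) ℂ) : ℂ :=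
  let e : (Fin k × Fin k) ⊕ Fin N ≃ Fin (k * n) :=
    ((Equiv.sumCongr finProdFinEquiv (Equiv.refl (Fin N))).trans finSumFinEquiv).trans (finCongr hN)
  let w : (Fin k × Fin k) ⊕ Fin N → Matrix (Fin k) (Fin n) ℂ :=
    Sum.elim (fun ij => Matrix.single ij.1 ij.2 (1 : ℂ) * C) v
  (Matrix.of fun x y : Fin (k * n) =>
    w (e.symm y) (finProdFinEquiv.symm x).1 (finProdFinEquiv.symm x).2).det

/-- The partial derivative of a matrix-valued map in the `i`-th complex coordinate. -/
def partialDeriv {k n N : ℕ} (G : (Fin N → ℂ) → Matrix (Fin k) (Fin n) ℂ) (i : Fin N)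
    (z : Fin N → ℂ) : Matrix (Fin k) (Fin n) ℂ :=
  Matrix.of fun r j => fderiv ℂ (fun w => G w r j) z (Pi.single i 1)

/-- The pull-back of `d^{k × n} C / vol(GL(k))` by `G`, as a multiple of `dz₁ ∧ ⋯ ∧ dz_N`. -/
def density {k n N : ℕ} (hN : k * k + N = k * n) (G : (Fin N → ℂ) → Matrix (Fin k) (Fin n) ℂ)
    (z : Fin N → ℂ) : ℂ :=
  grassmannForm hN (G z) (fun i => partialDeriv G i z)

/-- `G` is a holomorphic parametrization, on the open set `Ω`, of an open part of the Grassmannian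
(by matrices representing its points), in which the locus of the relations `L` is given by the
vanishing of the coordinates `z i`, `i ∈ A`. -/
structure IsResidueChart {k n N : ℕ} (hN : k * k + N = k * n) (L : Finset (LinRel n))
    (A : Finset (Fin N)) (Ω : Set (Fin N → ℂ)) (G : (Fin N → ℂ) → Matrix (Fin k) (Fin n) ℂ) :
    Prop where
  isOpen : IsOpen Ω
  holomorphic : ∀ r j, AnalyticOnNhd ℂ (fun z => G z r j) Ω
  nondegenerate : ∀ z ∈ Ω, density hN G z ≠ 0
  mem_locus_iff : ∀ z ∈ Ω, G z ∈ locus k L ↔ ∀ i ∈ A, z i = 0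

/-- The circle of radius `ε` around `0`, traversed once for parameters in `[0, 1]`. -/
def circlePath (ε : ℝ) (θ : ℝ) : ℂ := ε * Complex.exp (2 * Real.pi * Complex.I * θ)

/-- The integrand of `topForm` on the unit cube, in the real parameters `s` of the contour. -/
def topFormIntegrand {k n N : ℕ} {E : Type*} [NormedAddCommGroup E] [NormedSpace ℂ E]
    (hN : k * k + N = k * n) (G : (Fin N → ℂ) → Matrix (Fin k) (Fin n) ℂ)
    (γ : Fin N → ℝ → ℂ) (f : Matrix (Fin k) (Fin n) ℂ → ℂ)
    (φ : Matrix (Fin k) (Fin n) ℂ → E) (s : Fin N → ℝ) : E :=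
  ((∏ i, deriv (γ i) (s i)) * (1 / f (G fun i => γ i (s i))) * density hN G fun i => γ i (s i)) •
    φ (G fun i => γ i (s i))

/-- The top-form `∮ d^{k × n} C / vol(GL(k)) · φ(C) / f(C)`, in the coordinates `z` of the
parametrization `G`: the `i`-th coordinate runs over the path `γ i`, and each coordinate
transverse to the locus (`i ∈ A`) contributes a factor `1 / (2πi)`. -/
def topForm {k n N : ℕ} {E : Type*} [NormedAddCommGroup E] [NormedSpace ℂ E]
    (hN : k * k + N = k * n) (A : Finset (Fin N)) (G : (Fin N → ℂ) → Matrix (Fin k) (Fin n) ℂ)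
    (γ : Fin N → ℝ → ℂ) (f : Matrix (Fin k) (Fin n) ℂ → ℂ)
    (φ : Matrix (Fin k) (Fin n) ℂ → E) : E :=
  ((2 * Real.pi * Complex.I : ℂ) ^ A.card)⁻¹ •
    ∫ s in Set.Icc (0 : Fin N → ℝ) 1, topFormIntegrand hN G γ f φ s

/-- Attaching the bridge `(a, b)` to a top-form: `∫ dα / α ∧ 𝒯`, where `C` is replaced by
`C B(a, b; α)` in the argument of `φ` and `α` runs over the path `q`. -/
def attachBridge {k n N : ℕ} {E : Type*} [NormedAddCommGroup E] [NormedSpace ℂ E]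
    (hN : k * k + N = k * n) (A : Finset (Fin N)) (G : (Fin N → ℂ) → Matrix (Fin k) (Fin n) ℂ)
    (γ : Fin N → ℝ → ℂ) (f : Matrix (Fin k) (Fin n) ℂ → ℂ)
    (φ : Matrix (Fin k) (Fin n) ℂ → E) (a b : Fin n) (q : ℝ → ℂ) : E :=
  ∫ u in (0 : ℝ)..1, (deriv q u / q u) •
    topForm hN A G γ f (fun C => φ (C * bridge a b (q u)))

/-- The parametrization after the bridge has been attached: the coordinate `i₀` is set to `0` in
the old parametrization and is used as the bridge parameter. -/
def bridgedChart {k n N : ℕ} (a b : Fin n) (i₀ : Fin N)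
    (G : (Fin N → ℂ) → Matrix (Fin k) (Fin n) ℂ) (z : Fin N → ℂ) : Matrix (Fin k) (Fin n) ℂ :=
  G (Function.update z i₀ 0) * bridge a b (z i₀)

/-- The domain of `bridgedChart`. -/
def bridgedDomain {N : ℕ} (i₀ : Fin N) (Ω : Set (Fin N → ℂ)) : Set (Fin N → ℂ) :=
  {z | Function.update z i₀ 0 ∈ Ω}

end TopForm

end

namespace TopForm

open Matrix Submodule

/-! ### The bridge matrix -/

section Bridge

variable {k n : ℕ} {a b : Fin n}

/-! The bridge is a transvection: it has determinant one and inverse `B(a, b; -α)`, and it changes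
neither the span of columns containing `a` nor that of columns avoiding `b`.

Geometry: where `(a, a₂ … c_m) ≠ 0`, the columns `c₁ … c_m` are independent, so a rank bound `m` on
a set containing them forces its span to be theirs. The minor `(v, a₂ … c_m)`, as a linear
functional of `v`, kills this span and not `a`. Hence `t_{1,b} = 0` on `Γ`, and a bridge shifts
`t_{1,b}` from `0` to `α`. Conversely, undoing on `Γ̂` the bridge with `α` read off from the minors
leaves `b` in the span of `a` and `S` with vanishing functional, thus in the span of `S`. Every
relation with `b` but not `a` contains `S`, so `b` is redundant in it and the relation is restored
(`mul_bridge_neg_mem_locus`).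

Measure: the new chart has the same density as the old one at `z_{i₀} = 0` (`density_bridgedChart`).
The tangent vector `∂_{i₀} G` is replaced by `G E_{ab}`, but the differential of `(b, a₂ … c_m)`
takes the same nonzero value on both and kills all the other contracted vectors, so the determinant
does not change.

Integral: `f = t_{1,b} (a, a₂ … c_m) f̄`, so the small circle is a residue at a simple pole and
amounts to averaging a holomorphic function, which gives its value at `t_{1,b} = 0`. What remains is
the integrand of the bridged top-form, where `1/α` comes from `(b̂, a₂ … c_m) = α (a, a₂ … c_m)`.
The cube variable freed by the circle becomes the parameter of the path of `α`
(`integral_smul_integral_circle_eq`, `attachBridge_eq_topForm`). -/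

theorem det_bridge (hab : a ≠ b) (α : ℂ) : (bridge a b α).det = 1 :=
  det_transvection_of_ne a b hab α

theorem bridge_zero (a b : Fin n) : bridge a b 0 = 1 := by simp [bridge]

theorem bridge_mul_bridge (hab : a ≠ b) (α β : ℂ) :
    bridge a b α * bridge a b β = bridge a b (α + β) :=
  transvection_mul_transvection_same a b hab α β

theorem mul_bridge_mul_bridge_neg (hab : a ≠ b) (C : Matrix (Fin k) (Fin n) ℂ) (α : ℂ) :
    C * bridge a b α * bridge a b (-α) = C := by
  rw [Matrix.mul_assoc, bridge_mul_bridge hab, add_neg_cancel, bridge_zero, Matrix.mul_one]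

theorem mul_bridge_neg_mul_bridge (hab : a ≠ b) (C : Matrix (Fin k) (Fin n) ℂ) (α : ℂ) :
    C * bridge a b (-α) * bridge a b α = C := by
  rw [Matrix.mul_assoc, bridge_mul_bridge hab, neg_add_cancel, bridge_zero, Matrix.mul_one]

theorem mul_bridge_apply_same (C : Matrix (Fin k) (Fin n) ℂ) (a b : Fin n) (α : ℂ) (r : Fin k) :
    (C * bridge a b α) r b = C r b + α * C r a :=
  mul_transvection_apply_same a b r α C

theorem mul_bridge_apply_of_ne (C : Matrix (Fin k) (Fin n) ℂ) (a : Fin n) (α : ℂ) (r : Fin k)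
    {j : Fin n} (hj : j ≠ b) : (C * bridge a b α) r j = C r j :=
  mul_transvection_apply_of_ne a b r j hj α C

theorem mul_bridge_apply (C : Matrix (Fin k) (Fin n) ℂ) (a b : Fin n) (α : ℂ) (r : Fin k)
    (j : Fin n) : (C * bridge a b α) r j = C r j + if j = b then α * C r a else 0 := by
  split_ifs with h
  · rw [h, mul_bridge_apply_same]
  · rw [mul_bridge_apply_of_ne C a α r h, add_zero]

theorem rank_mul_bridge (hab : a ≠ b) (C : Matrix (Fin k) (Fin n) ℂ) (α : ℂ) :
    (C * bridge a b α).rank = C.rank :=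
  rank_mul_eq_left_of_isUnit_det _ _ (by rw [det_bridge hab]; exact isUnit_one)

end Bridge

/-! ### Minors under the bridge -/

section Minors

variable {k n : ℕ} {a b : Fin n}

theorem minor_eq_zero_of_not_injective (C : Matrix (Fin k) (Fin n) ℂ) {I : Fin k → Fin n}
    {i j : Fin k} (hij : i ≠ j) (h : I i = I j) : minor C I = 0 :=
  det_zero_of_column_eq hij fun r => by simp [h]

theorem minor_mul_bridge_of_forall_ne (C : Matrix (Fin k) (Fin n) ℂ) (α : ℂ) {I : Fin k → Fin n}
    (hI : ∀ i, I i ≠ b) : minor (C * bridge a b α) I = minor C I := by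
  refine congrArg det ?_
  ext r i
  exact mul_bridge_apply_of_ne C a α r (hI i)

theorem replace_ne (hab : a ≠ b) (I : Fin k → Fin n) (i : Fin k) :
    (if I i = b then a else I i) ≠ b := by
  split_ifs with h
  · exact hab
  · exact h

theorem minor_mul_bridge_of_exists (C : Matrix (Fin k) (Fin n) ℂ) (α : ℂ) {I : Fin k → Fin n}
    (hI : ∃ i, I i = b) :
    minor (C * bridge a b α) I =
      minor C I + α * minor C (fun i => if I i = b then a else I i) := by
  obtain ⟨i, hi⟩ := hI
  -- An index sequence may repeat columns. If `b` occurs once, this is additivity of the determinant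
  -- in that column; if it occurs twice, every minor in the identity has a repeated column and
  -- vanishes.
  by_cases hu : ∀ j, I j = b → j = i
  · have h1 : (C * bridge a b α).submatrix id I =
        (C.submatrix id I).updateCol i ((fun r => C r b) + α • fun r => C r a) := by
      ext r j
      by_cases hj : j = i
      · subst hj
        simp [hi, mul_bridge_apply_same]
      · simp [hj, mul_bridge_apply_of_ne C a α r fun h => hj (hu j h)]
    have h2 : (C.submatrix id I).updateCol i (fun r => C r b) = C.submatrix id I := by
      ext r j
      by_cases hj : j = i
      · subst hj; simp [hi]
      · simp [hj]
    have h3 : (C.submatrix id I).updateCol i (fun r => C r a) =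
        C.submatrix id (fun j => if I j = b then a else I j) := by
      ext r j
      by_cases hj : j = i
      · subst hj; simp [hi]
      · have : I j ≠ b := fun h => hj (hu j h)
        simp [hj, this]
    rw [minor, h1, det_updateCol_add, det_updateCol_smul, h2, h3]
    rfl
  · push Not at hu
    obtain ⟨j, hj, hji⟩ := hu
    have hI : I j = I i := hj.trans hi.symm
    rw [minor_eq_zero_of_not_injective _ hji hI, minor_eq_zero_of_not_injective _ hji hI,
      minor_eq_zero_of_not_injective (I := fun i => if I i = b then a else I i) _ hji
        (by simp [hi, hj])]
    simp

theorem rewriteMinor_mul_bridge (hab : a ≠ b) (C : Matrix (Fin k) (Fin n) ℂ) (α : ℂ) :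
    rewriteMinor a b α (C * bridge a b α) = minor C := by
  funext I
  unfold rewriteMinor
  split_ifs with hI
  · rw [minor_mul_bridge_of_exists C α hI, minor_mul_bridge_of_forall_ne C α (replace_ne hab I)]
    ring
  · push Not at hI
    exact minor_mul_bridge_of_forall_ne C α hI

end Minors

/-! ### Minors `(x, a₂, …, c_m)` and the bridge parameter -/

section Cols

variable {p m n : ℕ} {a b : Fin n} {a' : Fin p → Fin n} {c : Fin m → Fin n}

theorem cols_ne {x j : Fin n} (ha' : ∀ i, a' i ≠ j) (hc : ∀ i, c i ≠ j) (hx : x ≠ j)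
    (i : Fin (p + m + 1)) : cols x a' c i ≠ j := by
  refine Fin.cases ?_ (fun i => ?_) i
  · simpa [cols] using hx
  · refine Fin.addCases (fun i => ?_) (fun i => ?_) i
    · simpa [cols] using ha' i
    · simpa [cols] using hc i

theorem minor_cols_mul_bridge (hab : a ≠ b) (ha' : ∀ i, a' i ≠ b) (hc : ∀ i, c i ≠ b)
    (C : Matrix (Fin (p + m + 1)) (Fin n) ℂ) (α : ℂ) :
    minor (C * bridge a b α) (cols a a' c) = minor C (cols a a' c) :=
  minor_mul_bridge_of_forall_ne C α (cols_ne ha' hc hab)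

theorem minor_cols_mul_bridge_same (ha' : ∀ i, a' i ≠ b) (hc : ∀ i, c i ≠ b)
    (C : Matrix (Fin (p + m + 1)) (Fin n) ℂ) (α : ℂ) :
    minor (C * bridge a b α) (cols b a' c) =
      minor C (cols b a' c) + α * minor C (cols a a' c) := by
  rw [minor_mul_bridge_of_exists C α ⟨0, by simp [cols]⟩]
  congr 3
  funext i
  refine Fin.cases ?_ (fun i => ?_) i
  · simp [cols]
  · refine Fin.addCases (fun i => ?_) (fun i => ?_) i
    · simp [cols, ha' i]
    · simp [cols, hc i]

theorem bridgeParam_mul_bridge (hab : a ≠ b) (ha' : ∀ i, a' i ≠ b) (hc : ∀ i, c i ≠ b)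
    {C : Matrix (Fin (p + m + 1)) (Fin n) ℂ} (hC : minor C (cols a a' c) ≠ 0) (α : ℂ) :
    bridgeParam a b a' c (C * bridge a b α) = bridgeParam a b a' c C + α := by
  unfold bridgeParam
  rw [minor_cols_mul_bridge hab ha' hc, minor_cols_mul_bridge_same ha' hc]
  field_simp

theorem bridgedFun_mul_bridge (hab : a ≠ b) (ha' : ∀ i, a' i ≠ b) (hc : ∀ i, c i ≠ b) {w : ℕ}
    (fbar : MinorFun (p + m + 1) n w) {C : Matrix (Fin (p + m + 1)) (Fin n) ℂ}
    (hC : minor C (cols a a' c) ≠ 0) (hCb : minor C (cols b a' c) = 0) (α : ℂ) :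
    bridgedFun a b a' c fbar (C * bridge a b α) = α * minor C (cols a a' c) * fbar.val C := by
  have h0 : bridgeParam a b a' c C = 0 := by simp [bridgeParam, hCb]
  rw [bridgedFun, bridgeParam_mul_bridge hab ha' hc hC, h0, zero_add, rewriteMinor_mul_bridge hab,
    minor_cols_mul_bridge_same ha' hc, hCb, zero_add]
  rfl

end Cols

/-! ### Spans of columns -/

section ColSpan

variable {k n : ℕ} {a b : Fin n}

/-- The span of the columns of `C` with index in `R`. -/
def colSpan (C : Matrix (Fin k) (Fin n) ℂ) (R : Finset (Fin n)) : Submodule ℂ (Fin k → ℂ) :=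
  span ℂ (C.col '' R)

theorem rank_submatrix_eq_finrank_colSpan (C : Matrix (Fin k) (Fin n) ℂ) (R : Finset (Fin n)) :
    (C.submatrix id (fun j : {j // j ∈ R} => j.1)).rank = Module.finrank ℂ (colSpan C R) := by
  have h : Set.range (C.submatrix id (fun j : {j // j ∈ R} => j.1)).col = C.col '' R := by
    ext v
    constructor
    · rintro ⟨j, rfl⟩
      exact ⟨j.1, j.2, rfl⟩
    · rintro ⟨j, hj, rfl⟩
      exact ⟨⟨j, hj⟩, rfl⟩
  rw [rank_eq_finrank_span_cols, colSpan, h]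

theorem mem_locus {C : Matrix (Fin k) (Fin n) ℂ} {L : Finset (LinRel n)} :
    C ∈ locus k L ↔ C.rank = k ∧ ∀ R ∈ L, Module.finrank ℂ (colSpan C R.1) ≤ R.2 := by
  simp only [locus, Set.mem_ofPred_eq, rank_submatrix_eq_finrank_colSpan]

theorem col_mem_colSpan (C : Matrix (Fin k) (Fin n) ℂ) {R : Finset (Fin n)} {j : Fin n}
    (hj : j ∈ R) : C.col j ∈ colSpan C R :=
  subset_span ⟨j, hj, rfl⟩

theorem colSpan_le {C : Matrix (Fin k) (Fin n) ℂ} {R : Finset (Fin n)}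
    {W : Submodule ℂ (Fin k → ℂ)} : colSpan C R ≤ W ↔ ∀ j ∈ R, C.col j ∈ W := by
  rw [colSpan, span_le]
  exact Set.image_subset_iff

theorem colSpan_mono (C : Matrix (Fin k) (Fin n) ℂ) {R R' : Finset (Fin n)} (h : R ⊆ R') :
    colSpan C R ≤ colSpan C R' :=
  span_mono (Set.image_mono h)

theorem col_mul_bridge_same (C : Matrix (Fin k) (Fin n) ℂ) (a b : Fin n) (α : ℂ) :
    (C * bridge a b α).col b = C.col b + α • C.col a := by
  ext r
  exact mul_bridge_apply_same C a b α r

theorem col_mul_bridge_of_ne (C : Matrix (Fin k) (Fin n) ℂ) (a : Fin n) (α : ℂ) {j : Fin n}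
    (hj : j ≠ b) : (C * bridge a b α).col j = C.col j := by
  ext r
  exact mul_bridge_apply_of_ne C a α r hj

theorem colSpan_mul_bridge_of_notMem (C : Matrix (Fin k) (Fin n) ℂ) (α : ℂ)
    {R : Finset (Fin n)} (hb : b ∉ R) : colSpan (C * bridge a b α) R = colSpan C R := by
  unfold colSpan
  congr 1
  refine Set.image_congr fun j hj => col_mul_bridge_of_ne C a α ?_
  rintro rfl
  exact hb hj

theorem colSpan_mul_bridge_le (C : Matrix (Fin k) (Fin n) ℂ) (α : ℂ)
    {R : Finset (Fin n)} (ha : a ∈ R) : colSpan (C * bridge a b α) R ≤ colSpan C R := by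
  refine colSpan_le.2 fun j hj => ?_
  by_cases h : j = b
  · subst h
    rw [col_mul_bridge_same]
    exact add_mem (col_mem_colSpan C hj) (smul_mem _ _ (col_mem_colSpan C ha))
  · rw [col_mul_bridge_of_ne C a α h]
    exact col_mem_colSpan C hj

theorem colSpan_mul_bridge_of_mem (hab : a ≠ b) (C : Matrix (Fin k) (Fin n) ℂ) (α : ℂ)
    {R : Finset (Fin n)} (ha : a ∈ R) : colSpan (C * bridge a b α) R = colSpan C R := by
  refine le_antisymm (colSpan_mul_bridge_le C α ha) ?_
  -- The reverse inclusion is the same inclusion for the inverse bridge.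
  conv_lhs => rw [← mul_bridge_mul_bridge_neg hab C α]
  exact colSpan_mul_bridge_le _ _ ha

theorem colSpan_insert (C : Matrix (Fin k) (Fin n) ℂ) (j : Fin n) (R : Finset (Fin n)) :
    colSpan C (insert j R) = span ℂ {C.col j} ⊔ colSpan C R := by
  rw [colSpan, Finset.coe_insert, Set.image_insert_eq, span_insert, colSpan]

theorem finrank_colSpan_insert_le (C : Matrix (Fin k) (Fin n) ℂ) (j : Fin n)
    (R : Finset (Fin n)) :
    Module.finrank ℂ (colSpan C (insert j R)) ≤ Module.finrank ℂ (colSpan C R) + 1 := by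
  rw [colSpan_insert]
  refine (finrank_add_le_finrank_add_finrank _ _).trans ?_
  rw [add_comm]
  gcongr
  exact (finrank_span_le_card ({C.col j} : Set (Fin k → ℂ))).trans (by simp)

end ColSpan

/-! ### The locus before and after the bridge -/

section Locus

variable {p m n : ℕ} {a b : Fin n} {a' : Fin p → Fin n} {c : Fin m → Fin n} {S : Finset (Fin n)}

/-- The minor `(v, a₂, …, c_m)` as a linear function of its first column `v`. -/
theorem exists_linear_minor_cols (C : Matrix (Fin (p + m + 1)) (Fin n) ℂ) (a' : Fin p → Fin n)
    (c : Fin m → Fin n) : ∃ D : (Fin (p + m + 1) → ℂ) →ₗ[ℂ] ℂ,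
      ∀ j, D (C.col j) = minor C (cols j a' c) := by
  cases n with
  | zero => exact ⟨0, fun j => j.elim0⟩
  | succ n =>
    refine ⟨LinearMap.proj 0 ∘ₗ cramer (C.submatrix id (cols 0 a' c)), fun j => ?_⟩
    rw [LinearMap.comp_apply, LinearMap.proj_apply, cramer_apply, minor]
    congr 1
    ext r i
    refine Fin.cases ?_ (fun i => ?_) i
    · simp [cols]
    · simp [cols]

theorem finrank_span_cols (C : Matrix (Fin (p + m + 1)) (Fin n) ℂ)
    (hC : minor C (cols a a' c) ≠ 0) :
    Module.finrank ℂ (span ℂ (Set.range fun i => C.col (c i))) = m := by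
  have h := linearIndependent_cols_of_det_ne_zero hC
  have h2 := h.comp (fun i : Fin m => (Fin.natAdd p i).succ)
    (fun i j hij => Fin.natAdd_injective _ _ (Fin.succ_injective _ hij))
  have h3 : ((C.submatrix id (cols a a' c)).col ∘ fun i : Fin m => (Fin.natAdd p i).succ) =
      fun i => C.col (c i) := by
    funext i
    ext r
    simp [cols]
  rw [h3] at h2
  rw [finrank_span_eq_card h2, Fintype.card_fin]

/-- The `m` columns `c i` are independent, being part of a nonzero maximal minor, so they already
exhaust a span of dimension at most `m` that contains them. -/
theorem colSpan_eq_span_cols (C : Matrix (Fin (p + m + 1)) (Fin n) ℂ)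
    (hC : minor C (cols a a' c) ≠ 0) {R : Finset (Fin n)} (hR : ∀ i, c i ∈ R)
    (hr : Module.finrank ℂ (colSpan C R) ≤ m) :
    span ℂ (Set.range fun i => C.col (c i)) = colSpan C R := by
  refine eq_of_le_of_finrank_le (span_le.2 ?_) (by rwa [finrank_span_cols C hC])
  rintro _ ⟨i, rfl⟩
  exact col_mem_colSpan C (hR i)

theorem map_eq_zero_of_mem_span_cols {C : Matrix (Fin (p + m + 1)) (Fin n) ℂ}
    {D : (Fin (p + m + 1) → ℂ) →ₗ[ℂ] ℂ} (hD : ∀ j, D (C.col j) = minor C (cols j a' c))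
    {v : Fin (p + m + 1) → ℂ} (hv : v ∈ span ℂ (Set.range fun i => C.col (c i))) : D v = 0 := by
  have : span ℂ (Set.range fun i => C.col (c i)) ≤ LinearMap.ker D := by
    rw [span_le]
    rintro _ ⟨i, rfl⟩
    refine LinearMap.mem_ker.2 ((hD _).trans ?_)
    exact minor_eq_zero_of_not_injective C (Fin.succ_ne_zero (Fin.natAdd p i)).symm
      (by simp [cols])
  exact LinearMap.mem_ker.1 (this hv)

theorem minor_cols_eq_zero (hcS : ∀ i, c i ∈ S) {L : Finset (LinRel n)}
    (hL : (insert b S, m) ∈ L) {C : Matrix (Fin (p + m + 1)) (Fin n) ℂ}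
    (hCL : C ∈ locus (p + m + 1) L) (hC : minor C (cols a a' c) ≠ 0) :
    minor C (cols b a' c) = 0 := by
  obtain ⟨D, hD⟩ := exists_linear_minor_cols C a' c
  have hr := (mem_locus.1 hCL).2 _ hL
  have h := colSpan_eq_span_cols C hC (fun i => Finset.mem_insert_of_mem (hcS i)) hr
  rw [← hD]
  refine map_eq_zero_of_mem_span_cols hD ?_
  rw [h]
  exact col_mem_colSpan C (Finset.mem_insert_self _ _)

theorem bridgeParam_eq (hab : a ≠ b) (ha' : ∀ i, a' i ≠ b) (hcS : ∀ i, c i ∈ S) (hbS : b ∉ S)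
    {L : Finset (LinRel n)} (hL : (insert b S, m) ∈ L)
    {C : Matrix (Fin (p + m + 1)) (Fin n) ℂ}
    (hCL : C ∈ locus (p + m + 1) L) (hC : minor C (cols a a' c) ≠ 0) (α : ℂ) :
    bridgeParam a b a' c (C * bridge a b α) = α := by
  have hcb : ∀ i, c i ≠ b := fun i h => hbS (h ▸ hcS i)
  rw [bridgeParam_mul_bridge hab ha' hcb hC, bridgeParam,
    minor_cols_eq_zero hcS hL hCL hC, zero_div, zero_add]

/-- The converse direction for the distinguished relation: the two updated rank conditions give `b =
x a + w` with `w` in the span of `S`, and the vanishing minor forces `x = 0`. -/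
theorem col_mem_colSpan_of_minor_cols_eq_zero (hcS : ∀ i, c i ∈ S)
    {C : Matrix (Fin (p + m + 1)) (Fin n) ℂ} (hC : minor C (cols a a' c) ≠ 0)
    (hCb : minor C (cols b a' c) = 0) (hS : Module.finrank ℂ (colSpan C S) ≤ m)
    (habS : Module.finrank ℂ (colSpan C (insert a (insert b S))) ≤ m + 1) :
    C.col b ∈ colSpan C S := by
  obtain ⟨D, hD⟩ := exists_linear_minor_cols C a' c
  have hW := colSpan_eq_span_cols C hC hcS hS
  have hDS : ∀ v ∈ colSpan C S, D v = 0 := fun v hv =>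
    map_eq_zero_of_mem_span_cols hD (hW ▸ hv)
  have hlt : colSpan C S < colSpan C (insert a S) := by
    refine lt_of_le_of_ne (colSpan_mono C (Finset.subset_insert _ _)) fun h => hC ?_
    rw [← hD]
    exact hDS _ (h ▸ col_mem_colSpan C (Finset.mem_insert_self _ _))
  have hfin := finrank_lt_finrank_of_lt hlt
  rw [← hW, finrank_span_cols C hC] at hfin
  -- Dimension squeeze: `a` is outside the `m`-dimensional span of `S`, so the smaller space already
  -- has dimension at least `m + 1`, the bound for the larger one.
  have heq : colSpan C (insert a S) = colSpan C (insert a (insert b S)) :=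
    eq_of_le_of_finrank_le (colSpan_mono C (Finset.insert_subset_insert _
      (Finset.subset_insert _ _))) (habS.trans hfin)
  have hb : C.col b ∈ colSpan C (insert a S) := by
    rw [heq]
    exact col_mem_colSpan C (Finset.mem_insert_of_mem (Finset.mem_insert_self _ _))
  rw [colSpan_insert, mem_sup] at hb
  obtain ⟨y, hy, w, hw, hyw⟩ := hb
  obtain ⟨x, rfl⟩ := mem_span_singleton.1 hy
  have h0 := congrArg D hyw
  rw [map_add, map_smul, hD, hD, hCb, hDS w hw, add_zero, smul_eq_mul, mul_eq_zero] at h0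
  rw [← hyw, h0.resolve_right hC, zero_smul, zero_add]
  exact hw

/-- Both replacement relations concern sets whose span the bridge preserves; before the bridge,
adding `a` raises the rank by at most one and dropping `b` does not raise it. No minor has to be
nonzero here. -/
theorem mul_bridge_mem_locus_updateRels (hab : a ≠ b) {L : Finset (LinRel n)} {k : ℕ}
    {C : Matrix (Fin k) (Fin n) ℂ} (hC : C ∈ locus k L) (α : ℂ) :
    C * bridge a b α ∈ locus k (updateRels a b L) := by
  obtain ⟨hr, hL⟩ := mem_locus.1 hC
  refine mem_locus.2 ⟨(rank_mul_bridge hab C α).trans hr, fun R' hR' => ?_⟩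
  obtain ⟨R, hR, hR'⟩ := Finset.mem_biUnion.1 hR'
  unfold updateRel at hR'
  split_ifs at hR' with h
  · rw [Finset.mem_insert, Finset.mem_singleton] at hR'
    rcases hR' with rfl | rfl
    · rw [colSpan_mul_bridge_of_mem hab C α (Finset.mem_insert_self _ _)]
      exact (finrank_colSpan_insert_le C a R.1).trans (Nat.add_le_add_right (hL R hR) 1)
    · rw [colSpan_mul_bridge_of_notMem C α (Finset.notMem_erase _ _)]
      exact (finrank_mono (colSpan_mono C (Finset.erase_subset _ _))).trans (hL R hR)
  · rw [Finset.mem_singleton] at hR'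
    subst hR'
    by_cases ha : a ∈ R'.1
    · rw [colSpan_mul_bridge_of_mem hab C α ha]
      exact hL _ hR
    · rw [colSpan_mul_bridge_of_notMem C α fun hb => h ⟨hb, ha⟩]
      exact hL _ hR

theorem mul_bridge_neg_mem_locus (hab : a ≠ b) (ha' : ∀ i, a' i ≠ b) (hcS : ∀ i, c i ∈ S)
    (haS : a ∉ S) (hbS : b ∉ S) {L : Finset (LinRel n)} (hL : (insert b S, m) ∈ L)
    (hLmin : ∀ R ∈ L, b ∈ R.1 → a ∉ R.1 → insert b S ⊆ R.1)
    {C : Matrix (Fin (p + m + 1)) (Fin n) ℂ} (hC : minor C (cols a a' c) ≠ 0)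
    (hCL : C ∈ locus (p + m + 1) (updateRels a b L)) :
    C * bridge a b (-bridgeParam a b a' c C) ∈ locus (p + m + 1) L := by
  have hcb : ∀ i, c i ≠ b := fun i h => hbS (h ▸ hcS i)
  obtain ⟨hr, hup⟩ := mem_locus.1 hCL
  set β := -bridgeParam a b a' c C with hβ
  -- The two rank bounds that the update provides for each altered relation.
  have hmem : ∀ R ∈ L, b ∈ R.1 → a ∉ R.1 →
      Module.finrank ℂ (colSpan C (insert a R.1)) ≤ R.2 + 1 ∧
      Module.finrank ℂ (colSpan C (R.1.erase b)) ≤ R.2 := fun R hR hb ha =>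
    ⟨hup (insert a R.1, R.2 + 1) (Finset.mem_biUnion.2 ⟨R, hR, by simp [updateRel, hb, ha]⟩),
      hup (R.1.erase b, R.2) (Finset.mem_biUnion.2 ⟨R, hR, by simp [updateRel, hb, ha]⟩)⟩
  have hS := hmem _ hL (Finset.mem_insert_self _ _) (by simp [hab, haS])
  rw [Finset.erase_insert hbS] at hS
  have hb : (C * bridge a b β).col b ∈ colSpan (C * bridge a b β) S := by
    refine col_mem_colSpan_of_minor_cols_eq_zero (a := a) (a' := a') hcS ?_ ?_ ?_ ?_
    · rwa [minor_cols_mul_bridge hab ha' hcb]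
    · rw [minor_cols_mul_bridge_same ha' hcb, hβ, bridgeParam]
      field_simp
      ring
    · rw [colSpan_mul_bridge_of_notMem C β hbS]
      exact hS.2
    · rw [colSpan_mul_bridge_of_mem hab C β (Finset.mem_insert_self _ _)]
      exact hS.1
  refine mem_locus.2 ⟨(rank_mul_bridge hab C β).trans hr, fun R hR => ?_⟩
  by_cases hbR : b ∈ R.1
  · by_cases haR : a ∈ R.1
    · rw [colSpan_mul_bridge_of_mem hab C β haR]
      exact hup R (Finset.mem_biUnion.2 ⟨R, hR, by simp [updateRel, haR]⟩)
    -- By `hLmin` the remaining columns of the relation contain `S`, whose span contains the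
    -- unbridged column `b`; so `b` adds nothing to the rank.
    · have hsub : S ⊆ R.1.erase b := fun j hj => Finset.mem_erase.2
        ⟨fun h => hbS (h ▸ hj), hLmin R hR hbR haR (Finset.mem_insert_of_mem hj)⟩
      have hle : colSpan (C * bridge a b β) R.1 ≤ colSpan (C * bridge a b β) (R.1.erase b) := by
        refine colSpan_le.2 fun j hj => ?_
        by_cases hjb : j = b
        · subst hjb
          exact colSpan_mono _ hsub hb
        · exact col_mem_colSpan _ (Finset.mem_erase.2 ⟨hjb, hj⟩)
      refine (finrank_mono hle).trans ?_
      rw [colSpan_mul_bridge_of_notMem C β (Finset.notMem_erase _ _)]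
      exact (hmem R hR hbR haR).2
  · rw [colSpan_mul_bridge_of_notMem C β hbR]
    exact hup R (Finset.mem_biUnion.2 ⟨R, hR, by simp [updateRel, hbR]⟩)

theorem locus_updateRels_inter (hab : a ≠ b) (ha' : ∀ i, a' i ≠ b) (hcS : ∀ i, c i ∈ S)
    (haS : a ∉ S) (hbS : b ∉ S) {L : Finset (LinRel n)} (hL : (insert b S, m) ∈ L)
    (hLmin : ∀ R ∈ L, b ∈ R.1 → a ∉ R.1 → insert b S ⊆ R.1) :
    locus (p + m + 1) (updateRels a b L) ∩ {C | minor C (cols a a' c) ≠ 0} =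
      {D | ∃ C ∈ locus (p + m + 1) L, minor C (cols a a' c) ≠ 0 ∧
        ∃ α : ℂ, D = C * bridge a b α} := by
  have hcb : ∀ i, c i ≠ b := fun i h => hbS (h ▸ hcS i)
  ext D
  constructor
  · rintro ⟨hD, hDa⟩
    exact ⟨_, mul_bridge_neg_mem_locus hab ha' hcS haS hbS hL hLmin hDa hD,
      by rwa [minor_cols_mul_bridge hab ha' hcb], bridgeParam a b a' c D,
      (mul_bridge_neg_mul_bridge hab D _).symm⟩
  · rintro ⟨C, hC, hCa, α, rfl⟩
    refine ⟨mul_bridge_mem_locus_updateRels hab hC α, ?_⟩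
    rwa [Set.mem_ofPred_eq, minor_cols_mul_bridge hab ha' hcb]

end Locus

end TopForm

namespace TopForm

open MvPolynomial

/-! ### The integrand after the bridge -/

section Homogenize

theorem eval_mul_of_isHomogeneous {σ : Type*} [Fintype σ] {P : MvPolynomial σ ℂ} {d : ℕ}
    (hP : P.IsHomogeneous d) (t : ℂ) (x : σ → ℂ) :
    eval (fun i => t * x i) P = t ^ d * eval x P := by
  rw [eval_eq', eval_eq', Finset.mul_sum]
  refine Finset.sum_congr rfl fun e he => ?_
  have hd : ∑ i, e i = d := by
    rw [← Finsupp.degree_eq_sum, Finsupp.degree_eq_weight_one]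
    exact hP (mem_support_iff.1 he)
  simp_rw [mul_pow]
  rw [Finset.prod_mul_distrib, Finset.prod_pow_eq_pow_sum, hd]
  ring

variable {k n : ℕ}

/-- The rewriting of the minors, with the parameter `α = X_B / X_A` and cleared denominators. -/
noncomputable def rewritePoly (a b : Fin n) (A B : Fin k → Fin n) (I : Fin k → Fin n) :
    MvPolynomial (Fin k → Fin n) ℂ :=
  if ∃ i, I i = b then X A * X I - X B * X (fun i => if I i = b then a else I i)
  else X A * X I

theorem rewritePoly_isHomogeneous (a b : Fin n) (A B I : Fin k → Fin n) :
    (rewritePoly a b A B I).IsHomogeneous 2 := by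
  unfold rewritePoly
  split_ifs
  · exact ((isHomogeneous_X _ _).mul (isHomogeneous_X _ _)).sub
      ((isHomogeneous_X _ _).mul (isHomogeneous_X _ _))
  · exact (isHomogeneous_X _ _).mul (isHomogeneous_X _ _)

theorem eval_rewritePoly (a b : Fin n) {A B : Fin k → Fin n} {C : Matrix (Fin k) (Fin n) ℂ}
    (hA : minor C A ≠ 0) (I : Fin k → Fin n) :
    eval (minor C) (rewritePoly a b A B I) =
      minor C A * rewriteMinor a b (minor C B / minor C A) C I := by
  unfold rewritePoly rewriteMinor
  split_ifs
  · simp only [map_sub, map_mul, eval_X]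
    field_simp
  · simp only [map_mul, eval_X]

/-- Each rewritten minor has been multiplied by `(A)` to clear the denominator of `α`; homogeneity
of degree `d` collects these factors into `(A) ^ d`. -/
theorem eval_aeval_rewritePoly (a b : Fin n) {A B : Fin k → Fin n}
    {C : Matrix (Fin k) (Fin n) ℂ} (hA : minor C A ≠ 0) {P : MvPolynomial (Fin k → Fin n) ℂ}
    {d : ℕ} (hP : P.IsHomogeneous d) :
    eval (minor C) (aeval (rewritePoly a b A B) P) =
      minor C A ^ d * eval (rewriteMinor a b (minor C B / minor C A) C) P := by
  rw [← eval_mul_of_isHomogeneous hP, ← funext (eval_rewritePoly a b hA)]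
  rw [← MvPolynomial.coe_aeval_eq_eval, ← MvPolynomial.coe_aeval_eq_eval]
  change (aeval (minor C)) (aeval (rewritePoly a b A B) P) = _
  rw [← AlgHom.comp_apply, comp_aeval]
  rfl

end Homogenize

/-- Substituting the quadratic `rewritePoly` doubles degrees and leaves an excess `(A) ^ (n - 1)` in
the numerator, which the denominator must absorb. The degrees then differ by `1 + 2 (n - 1) - (n -
1) = n`. Neither polynomial is identically zero on matrices: at `C₀ B(a, b; 1)` the rewriting
returns the minors of the point `C₀` supplied by simplicity of the pole. -/
theorem exists_minorFun_val_eq_bridgedFun {p m n : ℕ} {a b : Fin n} {a' : Fin p → Fin n}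
    {c : Fin m → Fin n} (hab : a ≠ b) (ha' : ∀ i, a' i ≠ b) (hc : ∀ i, c i ≠ b)
    (fbar : MinorFun (p + m + 1) n (n - 1))
    (hpole : ∃ C, minor C (cols a a' c) ≠ 0 ∧ minor C (cols b a' c) = 0 ∧
      eval (minor C) fbar.num ≠ 0 ∧ eval (minor C) fbar.den ≠ 0) :
    ∃ fhat : MinorFun (p + m + 1) n n, ∀ C, minor C (cols a a' c) ≠ 0 →
      fhat.val C = bridgedFun a b a' c fbar C := by
  obtain ⟨C₀, ha, hb, hnum, hden⟩ := hpole
  -- Makes the truncated subtraction `n - 1` harmless in the degree count.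
  have hn : 0 < n := a.pos
  set A := cols a a' c
  set B := cols b a' c
  have hD : minor (C₀ * bridge a b 1) A ≠ 0 := by rwa [minor_cols_mul_bridge hab ha' hc]
  have hDB : minor (C₀ * bridge a b 1) B = minor C₀ A := by
    rw [minor_cols_mul_bridge_same ha' hc, hb, zero_add, one_mul]
  have hDx : rewriteMinor a b (minor (C₀ * bridge a b 1) B / minor (C₀ * bridge a b 1) A)
      (C₀ * bridge a b 1) = minor C₀ := by
    rw [hDB, minor_cols_mul_bridge hab ha' hc, div_self ha, rewriteMinor_mul_bridge hab]
  refine ⟨{ num := X B * aeval (rewritePoly a b A B) fbar.num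
            den := X A ^ (n - 1) * aeval (rewritePoly a b A B) fbar.den
            deg := (n - 1) + 2 * fbar.deg
            num_hom := ?_, den_hom := ?_, num_ne := ?_, den_ne := ?_ }, fun C hC => ?_⟩
  · have h := (isHomogeneous_X ℂ B).mul
      (fbar.num_hom.aeval (rewritePoly a b A B) (rewritePoly_isHomogeneous a b A B))
    rwa [show 1 + 2 * (fbar.deg + (n - 1)) = n - 1 + 2 * fbar.deg + n by lia] at h
  · have h := (isHomogeneous_X_pow A (n - 1)).mul
      (fbar.den_hom.aeval (rewritePoly a b A B) (rewritePoly_isHomogeneous a b A B))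
    exact h
  · refine ⟨C₀ * bridge a b 1, ?_⟩
    rw [map_mul, eval_X, eval_aeval_rewritePoly a b hD fbar.num_hom, hDx, hDB]
    exact mul_ne_zero ha (mul_ne_zero (pow_ne_zero _ hD) hnum)
  · refine ⟨C₀ * bridge a b 1, ?_⟩
    rw [map_mul, map_pow, eval_X, eval_aeval_rewritePoly a b hD fbar.den_hom, hDx]
    exact mul_ne_zero (pow_ne_zero _ hD) (mul_ne_zero (pow_ne_zero _ hD) hden)
  · change eval (minor C) (X B * aeval (rewritePoly a b A B) fbar.num) /
      eval (minor C) (X A ^ (n - 1) * aeval (rewritePoly a b A B) fbar.den) =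
      minor C B * (eval (rewriteMinor a b (minor C B / minor C A) C) fbar.num /
        eval (rewriteMinor a b (minor C B / minor C A) C) fbar.den)
    rw [map_mul, map_mul, map_pow, eval_X, eval_X, eval_aeval_rewritePoly a b hC fbar.num_hom,
      eval_aeval_rewritePoly a b hC fbar.den_hom, ← mul_assoc (minor C A ^ (n - 1)),
      ← pow_add, add_comm (n - 1), mul_left_comm, mul_div_mul_left _ _ (pow_ne_zero _ hC),
      mul_div_assoc]

end TopForm

namespace TopForm

open Matrix

/-! ### The density of the bridged parametrization -/

section GrassmannForm

variable {k n N : ℕ}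

/-- The square matrix whose columns are the matrices `w y`, written as vectors. -/
def vecMatrix {X Y : Type*} (f : Fin k × Fin n ≃ X) (e : Y ≃ X)
    (w : Y → Matrix (Fin k) (Fin n) ℂ) : Matrix X X ℂ :=
  Matrix.of fun x y => w (e.symm y) (f.symm x).1 (f.symm x).2

/-- On vectorized matrices, right multiplication by `B` is the Kronecker product `1 ⊗ Bᵀ`, of
determinant `det B ^ k`. -/
theorem det_vecMatrix_mul {X Y : Type*} [Fintype X] [DecidableEq X] (f : Fin k × Fin n ≃ X)
    (e : Y ≃ X) (w : Y → Matrix (Fin k) (Fin n) ℂ) (B : Matrix (Fin n) (Fin n) ℂ) :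
    (vecMatrix f e fun y => w y * B).det = B.det ^ k * (vecMatrix f e w).det := by
  have hdet : ((kroneckerMap (· * ·) (1 : Matrix (Fin k) (Fin k) ℂ) Bᵀ).submatrix
      f.symm f.symm).det = B.det ^ k := by
    rw [det_submatrix_equiv_self, det_kronecker]
    simp
  rw [← hdet, ← det_mul]
  refine congrArg det ?_
  ext x y
  simp only [vecMatrix, Matrix.mul_apply, of_apply, submatrix_apply, kroneckerMap_apply]
  rw [← f.sum_comp, Fintype.sum_prod_type]
  simp [one_apply, mul_comm]

/-- Cramer's rule in the form `∑ cramer M τ y • w y = det M • T` needs no invertibility. Applying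
`l` leaves only the `y₀` term, and cancelling `t` equates the two determinants. -/
theorem det_vecMatrix_update {X Y : Type*} [Fintype X] [DecidableEq X] [DecidableEq Y]
    (f : Fin k × Fin n ≃ X) (e : Y ≃ X) (w : Y → Matrix (Fin k) (Fin n) ℂ) (y₀ : Y)
    (T : Matrix (Fin k) (Fin n) ℂ) (l : Matrix (Fin k) (Fin n) ℂ →ₗ[ℂ] ℂ) {t : ℂ} (ht : t ≠ 0)
    (hw : ∀ y, l (w y) = if y = y₀ then t else 0) (hT : l T = t) :
    (vecMatrix f e (Function.update w y₀ T)).det = (vecMatrix f e w).det := by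
  set M := vecMatrix f e w with hM
  set τ : X → ℂ := fun x => T (f.symm x).1 (f.symm x).2 with hτ
  have hupd : vecMatrix f e (Function.update w y₀ T) = M.updateCol (e y₀) τ := by
    ext x y
    obtain ⟨y, rfl⟩ := e.surjective y
    by_cases h : y = y₀
    · subst h; simp [τ, vecMatrix]
    · simp [hM, vecMatrix, h]
  have hsum : ∑ y, cramer M τ y • w (e.symm y) = M.det • T := by
    ext r j
    have h := congrFun (mulVec_cramer M τ) (f (r, j))
    have hτ' : τ (f (r, j)) = T r j := by simp [hτ]
    have hM' : ∀ y, M (f (r, j)) y = w (e.symm y) r j := fun y => by simp [hM, vecMatrix]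
    simp only [mulVec, dotProduct, Pi.smul_apply, smul_eq_mul, hτ', hM'] at h
    rw [Matrix.sum_apply, Matrix.smul_apply, smul_eq_mul, ← h]
    exact Finset.sum_congr rfl fun y _ => mul_comm _ _
  have hl := congrArg l hsum
  simp only [map_sum, map_smul, hT, hw, smul_eq_mul, mul_ite, mul_zero] at hl
  rw [Finset.sum_eq_single (e y₀) (fun y _ hy => if_neg fun h => hy (by simp [← h]))
    (by simp), if_pos (by simp)] at hl
  rw [hupd, ← cramer_apply]
  exact mul_right_cancel₀ ht hl

/-- The order of the vectors contracted with the volume form in `grassmannForm`. -/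
def grassmannEquiv (hN : k * k + N = k * n) : (Fin k × Fin k) ⊕ Fin N ≃ Fin (k * n) :=
  ((Equiv.sumCongr finProdFinEquiv (Equiv.refl (Fin N))).trans finSumFinEquiv).trans
    (finCongr hN)

theorem grassmannForm_eq_det_vecMatrix (hN : k * k + N = k * n) (C : Matrix (Fin k) (Fin n) ℂ)
    (v : Fin N → Matrix (Fin k) (Fin n) ℂ) :
    grassmannForm hN C v = (vecMatrix finProdFinEquiv (grassmannEquiv hN)
      (Sum.elim (fun ij : Fin k × Fin k => Matrix.single ij.1 ij.2 (1 : ℂ) * C) v)).det :=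
  rfl

theorem grassmannForm_mul (hN : k * k + N = k * n) (C : Matrix (Fin k) (Fin n) ℂ)
    (v : Fin N → Matrix (Fin k) (Fin n) ℂ) (B : Matrix (Fin n) (Fin n) ℂ) :
    grassmannForm hN (C * B) (fun i => v i * B) = B.det ^ k * grassmannForm hN C v := by
  rw [grassmannForm_eq_det_vecMatrix, grassmannForm_eq_det_vecMatrix, ← det_vecMatrix_mul]
  congr 2
  funext y
  cases y <;> simp [Matrix.mul_assoc]

theorem grassmannForm_update (hN : k * k + N = k * n) (C : Matrix (Fin k) (Fin n) ℂ)
    (v : Fin N → Matrix (Fin k) (Fin n) ℂ) (i₀ : Fin N) (T : Matrix (Fin k) (Fin n) ℂ)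
    (l : Matrix (Fin k) (Fin n) ℂ →ₗ[ℂ] ℂ) {t : ℂ} (ht : t ≠ 0)
    (hlC : ∀ i j : Fin k, l (Matrix.single i j (1 : ℂ) * C) = 0)
    (hlv : ∀ i, l (v i) = if i = i₀ then t else 0) (hlT : l T = t) :
    grassmannForm hN C (Function.update v i₀ T) = grassmannForm hN C v := by
  rw [grassmannForm_eq_det_vecMatrix, grassmannForm_eq_det_vecMatrix, ← Sum.update_elim_inr]
  refine det_vecMatrix_update _ _ _ _ T l ht (fun y => ?_) hlT
  rcases y with y | y
  · simpa using hlC y.1 y.2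
  · simpa using hlv y

end GrassmannForm

/-! ### Derivatives of the minors and of the bridged chart -/

section Density

variable {k n N : ℕ}

theorem minor_eq_sum (C : Matrix (Fin k) (Fin n) ℂ) (I : Fin k → Fin n) :
    minor C I = ∑ σ : Equiv.Perm (Fin k), ((Equiv.Perm.sign σ : ℤ) : ℂ) * ∏ i, C (σ i) (I i) := by
  rw [minor, det_apply']
  rfl

/-- The differential of a minor at `C`. -/
theorem exists_linear_hasDerivAt_minor (C : Matrix (Fin k) (Fin n) ℂ) (I : Fin k → Fin n) :
    ∃ l : Matrix (Fin k) (Fin n) ℂ →ₗ[ℂ] ℂ,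
      ∀ (g : ℂ → Matrix (Fin k) (Fin n) ℂ) (g' : Matrix (Fin k) (Fin n) ℂ) (x : ℂ), g x = C →
        (∀ r j, HasDerivAt (fun t => g t r j) (g' r j) x) →
        HasDerivAt (fun t => minor (g t) I) (l g') x := by
  let F : (Fin k → Fin n → ℂ) → ℂ := fun X => minor (Matrix.of X) I
  have hF : Differentiable ℂ F := by
    simp only [F, minor_eq_sum, of_apply]
    fun_prop
  refine ⟨(fderiv ℂ F fun r j => C r j).toLinearMap, fun g g' x hg hd => ?_⟩
  have h1 : HasDerivAt (fun t r j => g t r j) (fun r j => g' r j) x :=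
    hasDerivAt_pi.2 fun r => hasDerivAt_pi.2 fun j => hd r j
  have h2 : HasFDerivAt F (fderiv ℂ F fun r j => C r j) (fun r j => g x r j) := by
    rw [hg]
    exact (hF _).hasFDerivAt
  exact h2.comp_hasDerivAt x h1

theorem hasDerivAt_line {F : (Fin N → ℂ) → ℂ} {z : Fin N → ℂ} (hF : DifferentiableAt ℂ F z)
    (v : Fin N → ℂ) : HasDerivAt (fun t : ℂ => F (z + t • v)) (fderiv ℂ F z v) 0 := by
  have h := hF.hasFDerivAt.hasLineDerivAt v
  exact h

variable {a b : Fin n} {G : (Fin N → ℂ) → Matrix (Fin k) (Fin n) ℂ} {i₀ : Fin N} {z : Fin N → ℂ}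

theorem hasDerivAt_chart_line (hG : ∀ r j, DifferentiableAt ℂ (fun z => G z r j) z) (i : Fin N)
    (r : Fin k) (j : Fin n) :
    HasDerivAt (fun t : ℂ => G (z + t • Pi.single i 1) r j) (partialDeriv G i z r j) 0 :=
  hasDerivAt_line (hG r j) (Pi.single i 1)

theorem analyticAt_update (i₀ : Fin N) (z : Fin N → ℂ) :
    AnalyticAt ℂ (fun w : Fin N → ℂ => Function.update w i₀ (0 : ℂ)) z := by
  refine analyticAt_pi_iff.2 fun i => ?_
  by_cases h : i = i₀
  · subst h
    simpa using analyticAt_const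
  · simp only [Function.update_of_ne h]
    exact (ContinuousLinearMap.proj (R := ℂ) (φ := fun _ : Fin N => ℂ) i).analyticAt z

/-- In the direction `i₀` only the bridge varies, with derivative `E_{ab}`; since `E_{ab} B =
E_{ab}` for `a ≠ b`, the factor `B` can be pulled out of every partial derivative, as
`grassmannForm_mul` requires. -/
theorem partialDeriv_bridgedChart (hab : a ≠ b)
    (hG : ∀ r j, DifferentiableAt ℂ (fun z => G z r j) (Function.update z i₀ 0)) (i : Fin N) :
    partialDeriv (bridgedChart a b i₀ G) i z =
      Function.update (fun i => partialDeriv G i (Function.update z i₀ 0)) i₀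
        (G (Function.update z i₀ 0) * Matrix.single a b (1 : ℂ)) i * bridge a b (z i₀) := by
  have hdiff : ∀ r j, DifferentiableAt ℂ (fun w => G (Function.update w i₀ 0) r j) z :=
    fun r j => DifferentiableAt.comp z (g := fun z => G z r j) (hG r j)
      (analyticAt_update i₀ z).differentiableAt
  have hc : ∀ r j, DifferentiableAt ℂ (fun w => bridgedChart a b i₀ G w r j) z := by
    intro r j
    simp only [bridgedChart, mul_bridge_apply]
    split_ifs
    · exact (hdiff r j).add ((differentiableAt_apply i₀ z).mul (hdiff r a))
    · simpa using hdiff r j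
  ext r j
  refine (hasDerivAt_chart_line hc i r j).unique ?_
  simp only [bridgedChart]
  by_cases hi : i = i₀
  · subst hi
    have hs : ∀ t : ℂ, Function.update (z + t • Pi.single i (1 : ℂ)) i 0 =
        Function.update z i 0 := by
      intro t
      ext l
      by_cases h : l = i
      · subst h; simp
      · simp [h]
    have hE : Matrix.single a b (1 : ℂ) * bridge a b (z i) = Matrix.single a b 1 := by
      rw [bridge, Matrix.mul_add, Matrix.mul_one, single_mul_single_of_ne _ _ _ _ hab.symm,
        add_zero]
    rw [Function.update_self, Matrix.mul_assoc, hE]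
    simp only [hs, mul_bridge_apply]
    by_cases hj : j = b
    · subst hj
      simp only [if_true, Pi.add_apply, Pi.smul_apply, Pi.single_eq_same, smul_eq_mul, mul_one,
        mul_single_apply_same]
      have := (((hasDerivAt_id (0 : ℂ)).const_add (z i)).mul_const
        (G (Function.update z i 0) r a)).const_add (G (Function.update z i 0) r j)
      simpa using this
    · simp only [if_neg hj, add_zero, mul_single_apply_of_ne _ _ _ _ _ hj]
      exact hasDerivAt_const _ _
  · have hs : ∀ t : ℂ, Function.update (z + t • Pi.single i (1 : ℂ)) i₀ 0 =
        Function.update z i₀ 0 + t • Pi.single i (1 : ℂ) := by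
      intro t
      ext l
      by_cases h : l = i₀
      · subst h; simp [Ne.symm hi]
      · simp [h]
    have hz : ∀ t : ℂ, (z + t • (Pi.single i 1 : Fin N → ℂ)) i₀ = z i₀ := by
      intro t
      simp [Ne.symm hi]
    simp only [hs, hz, Function.update_of_ne hi, mul_bridge_apply]
    have h := hasDerivAt_chart_line hG i
    split_ifs
    · exact (h r j).add ((h r a).const_mul (z i₀))
    · simpa using h r j

end Density

/-! ### Equality of the densities before and after the bridge -/

section DensityBridgedChart

variable {p m n N : ℕ} {a b : Fin n} {a' : Fin p → Fin n} {c : Fin m → Fin n}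
  {G : (Fin N → ℂ) → Matrix (Fin (p + m + 1)) (Fin n) ℂ} {i₀ : Fin N} {Ω : Set (Fin N → ℂ)}

theorem minor_cols_chart
    (ht : ∀ z ∈ Ω, minor (G z) (cols a a' c) ≠ 0 ∧ bridgeParam a b a' c (G z) = z i₀)
    {z : Fin N → ℂ} (hz : z ∈ Ω) :
    minor (G z) (cols b a' c) = z i₀ * minor (G z) (cols a a' c) := by
  rw [← (ht z hz).2, bridgeParam, div_mul_cancel₀ _ (ht z hz).1]

/-- The functional fed to `grassmannForm_update` is the differential `l` of `(b, a₂ … c_m)` at `G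
z₀`, a point where this minor vanishes; the common value `t` is `(a, a₂ … c_m)`. -/
theorem density_bridgedChart (hN : (p + m + 1) * (p + m + 1) + N = (p + m + 1) * n)
    (hab : a ≠ b) (ha' : ∀ i, a' i ≠ b) (hc : ∀ i, c i ≠ b) (hΩ : IsOpen Ω)
    (hG : ∀ z ∈ Ω, ∀ r j, DifferentiableAt ℂ (fun z => G z r j) z)
    (ht : ∀ z ∈ Ω, minor (G z) (cols a a' c) ≠ 0 ∧ bridgeParam a b a' c (G z) = z i₀)
    {z : Fin N → ℂ} (hz : Function.update z i₀ 0 ∈ Ω) :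
    density hN (bridgedChart a b i₀ G) z = density hN G (Function.update z i₀ 0) := by
  set z₀ := Function.update z i₀ 0 with hz₀
  have hz₀i : z₀ i₀ = 0 := by simp [hz₀]
  have hCb : minor (G z₀) (cols b a' c) = 0 := by
    rw [minor_cols_chart ht hz, hz₀i, zero_mul]
  obtain ⟨l, hl⟩ := exists_linear_hasDerivAt_minor (G z₀) (cols b a' c)
  obtain ⟨l', hl'⟩ := exists_linear_hasDerivAt_minor (G z₀) (cols a a' c)
  have hline : ∀ V : Matrix (Fin (p + m + 1)) (Fin n) ℂ,
      HasDerivAt (fun t : ℂ => minor (G z₀ + t • V) (cols b a' c)) (l V) 0 := by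
    refine fun V => hl _ V 0 (by simp) fun r j => ?_
    simpa using ((hasDerivAt_id (0 : ℂ)).mul_const (V r j)).const_add (G z₀ r j)
  unfold density
  simp_rw [partialDeriv_bridgedChart hab (hG z₀ hz)]
  rw [show bridgedChart a b i₀ G z = G z₀ * bridge a b (z i₀) from rfl, grassmannForm_mul,
    det_bridge hab, one_pow, one_mul]
  refine grassmannForm_update hN _ _ i₀ _ l (ht z₀ hz).1 (fun i j => ?_) (fun i => ?_) ?_
  -- Directions of `GL(k)`: left multiplication scales the minor by a determinant, so it stays zero
  -- along the line.
  · refine (hline _).unique ?_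
    have h : ∀ t : ℂ, minor (G z₀ + t • (Matrix.single i j (1 : ℂ) * G z₀)) (cols b a' c) = 0 := by
      intro t
      have : G z₀ + t • (Matrix.single i j (1 : ℂ) * G z₀) =
          (1 + t • Matrix.single i j (1 : ℂ)) * G z₀ := by
        rw [Matrix.add_mul, Matrix.one_mul, Matrix.smul_mul]
      rw [this, minor, ← Matrix.submatrix_mul_equiv _ _ id (Equiv.refl _), det_mul]
      exact mul_eq_zero_of_right _ hCb
    simp only [h]
    exact hasDerivAt_const _ _
  -- Coordinate directions: along the chart the minor is `z_{i₀} (a, a₂ … c_m)`, and `z_{i₀}`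
  -- vanishes at `z₀`, so only `i = i₀` contributes.
  · have hg := hasDerivAt_chart_line (hG z₀ hz) i
    refine (hl (fun t => G (z₀ + t • Pi.single i 1)) _ 0 (by simp) hg).unique ?_
    have hev : (fun t : ℂ => minor (G (z₀ + t • Pi.single i 1)) (cols b a' c)) =ᶠ[nhds 0]
        fun t => (t * if i = i₀ then 1 else 0) *
          minor (G (z₀ + t • Pi.single i 1)) (cols a a' c) := by
      have hcont : Continuous fun t : ℂ => z₀ + t • (Pi.single i 1 : Fin N → ℂ) := by fun_prop
      have hmem := hcont.continuousAt.preimage_mem_nhds (x := 0)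
        (hΩ.mem_nhds (by simpa using hz))
      filter_upwards [hmem] with t ht0
      rw [minor_cols_chart ht ht0]
      congr 1
      simp [hz₀i, Pi.single_apply, eq_comm]
    refine HasDerivAt.congr_of_eventuallyEq ?_ hev
    have h1 := hl' (fun t => G (z₀ + t • Pi.single i 1)) _ 0 (by simp) hg
    refine (((hasDerivAt_id (0 : ℂ)).mul_const (if i = i₀ then (1 : ℂ) else 0)).mul
      h1).congr_deriv ?_
    simp
  -- The new direction `G E_{ab}`: the line is the bridge itself, along which the minor grows as `t
  -- (a, a₂ … c_m)`.
  · refine (hline _).unique ?_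
    have h : ∀ t : ℂ, minor (G z₀ + t • (G z₀ * Matrix.single a b (1 : ℂ))) (cols b a' c) =
        t * minor (G z₀) (cols a a' c) := by
      intro t
      have : G z₀ + t • (G z₀ * Matrix.single a b (1 : ℂ)) = G z₀ * bridge a b t := by
        rw [bridge, Matrix.mul_add, Matrix.mul_one, ← Matrix.mul_smul, smul_single, smul_eq_mul,
          mul_one]
      rw [this, minor_cols_mul_bridge_same ha' hc, hCb, zero_add]
    refine HasDerivAt.congr_of_eventuallyEq ?_ (Filter.Eventually.of_forall h)
    simpa using (hasDerivAt_id (0 : ℂ)).mul_const (minor (G z₀) (cols a a' c))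

end DensityBridgedChart

end TopForm

namespace TopForm

open MeasureTheory Set

/-! ### Integration over the cube -/

section Cube

variable {E : Type*} [NormedAddCommGroup E] [NormedSpace ℂ E] {N : ℕ}

theorem insertNth_mem_cube_iff (i₀ : Fin (N + 1)) (t : ℝ) (s : Fin N → ℝ) :
    i₀.insertNth t s ∈ Icc (0 : Fin (N + 1) → ℝ) 1 ↔
      t ∈ Icc (0 : ℝ) 1 ∧ s ∈ Icc (0 : Fin N → ℝ) 1 := by
  simp only [mem_Icc, Pi.le_def, Fin.forall_iff_succAbove i₀, Fin.insertNth_apply_same,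
    Fin.insertNth_apply_succAbove, Pi.zero_apply, Pi.one_apply]
  tauto

theorem preimage_cube (i₀ : Fin (N + 1)) :
    (MeasurableEquiv.piFinSuccAbove (fun _ => ℝ) i₀).symm ⁻¹' Icc (0 : Fin (N + 1) → ℝ) 1 =
      Icc (0 : ℝ) 1 ×ˢ Icc (0 : Fin N → ℝ) 1 := by
  ext ⟨t, s⟩
  exact insertNth_mem_cube_iff i₀ t s

omit [NormedSpace ℂ E] in
theorem integrableOn_cube_prod (i₀ : Fin (N + 1)) {F : (Fin (N + 1) → ℝ) → E}
    (hF : IntegrableOn F (Icc 0 1)) :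
    IntegrableOn (fun x : ℝ × (Fin N → ℝ) => F (i₀.insertNth x.1 x.2))
      (Icc (0 : ℝ) 1 ×ˢ Icc (0 : Fin N → ℝ) 1) := by
  have he := (volume_preserving_piFinSuccAbove (fun _ : Fin (N + 1) => ℝ) i₀).symm
  rw [← preimage_cube i₀]
  exact (he.integrableOn_comp_preimage (MeasurableEquiv.measurableEmbedding _)).2 hF

theorem setIntegral_cube_eq_prod (i₀ : Fin (N + 1)) (F : (Fin (N + 1) → ℝ) → E) :
    ∫ s in Icc (0 : Fin (N + 1) → ℝ) 1, F s =
      ∫ x in Icc (0 : ℝ) 1 ×ˢ Icc (0 : Fin N → ℝ) 1, F (i₀.insertNth x.1 x.2) := by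
  have he := (volume_preserving_piFinSuccAbove (fun _ : Fin (N + 1) => ℝ) i₀).symm
  rw [← preimage_cube i₀]
  exact (he.setIntegral_preimage_emb (MeasurableEquiv.measurableEmbedding _) F _).symm

theorem setIntegral_cube (i₀ : Fin (N + 1)) {F : (Fin (N + 1) → ℝ) → E}
    (hF : IntegrableOn F (Icc 0 1)) :
    ∫ s in Icc (0 : Fin (N + 1) → ℝ) 1, F s =
      ∫ t in (0 : ℝ)..1, ∫ s in Icc (0 : Fin N → ℝ) 1, F (i₀.insertNth t s) := by
  rw [setIntegral_cube_eq_prod i₀, Measure.volume_eq_prod,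
    setIntegral_prod _ (integrableOn_cube_prod i₀ hF),
    intervalIntegral.integral_of_le zero_le_one, integral_Icc_eq_integral_Ioc]

theorem setIntegral_cube_symm (i₀ : Fin (N + 1)) {F : (Fin (N + 1) → ℝ) → E}
    (hF : IntegrableOn F (Icc 0 1)) :
    ∫ s in Icc (0 : Fin (N + 1) → ℝ) 1, F s =
      ∫ s in Icc (0 : Fin N → ℝ) 1, ∫ t in (0 : ℝ)..1, F (i₀.insertNth t s) := by
  have h := (integrableOn_cube_prod i₀ hF).swap
  rw [setIntegral_cube_eq_prod i₀, Measure.volume_eq_prod, ← setIntegral_prod_swap]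
  refine (setIntegral_prod _ h).trans ?_
  simp only [intervalIntegral.integral_of_le zero_le_one, integral_Icc_eq_integral_Ioc,
    Function.comp_apply, Prod.swap_prod_mk]

theorem circlePath_eq_circleMap (ε θ : ℝ) :
    circlePath ε θ = circleMap 0 ε (2 * Real.pi * θ) := by
  simp only [circlePath, circleMap]
  push_cast
  ring_nf

theorem integral_circlePath [CompleteSpace E] {g : ℂ → E} {ε : ℝ} (hε : 0 < ε)
    (hg : DiffContOnCl ℂ g (Metric.ball 0 ε)) :
    ∫ θ in (0 : ℝ)..1, g (circlePath ε θ) = g 0 := by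
  have h := DiffContOnCl.circleAverage (f := g) (c := 0) (R := ε) (by rwa [abs_of_pos hε])
  rw [← h, Real.circleAverage_def]
  simp_rw [circlePath_eq_circleMap]
  rw [intervalIntegral.integral_comp_mul_left (fun x => g (circleMap 0 ε x))
    (by positivity : 2 * Real.pi ≠ 0)]
  simp

theorem norm_circlePath {ε : ℝ} (hε : 0 < ε) (θ : ℝ) : ‖circlePath ε θ‖ = ε := by
  rw [circlePath_eq_circleMap, norm_circleMap_zero, abs_of_pos hε]

/-- The logarithmic derivative is the constant `2πi`, so a simple pole at `0` cancels against the
velocity and the contour integral becomes an average over the circle. -/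
theorem hasDerivAt_circlePath (ε θ : ℝ) :
    HasDerivAt (circlePath ε) (2 * Real.pi * Complex.I * circlePath ε θ) θ := by
  have h1 : HasDerivAt (fun t : ℝ => 2 * Real.pi * Complex.I * (t : ℂ))
      (2 * Real.pi * Complex.I * 1) θ :=
    (Complex.ofRealCLM.hasDerivAt (x := θ)).const_mul _
  have h2 := (h1.cexp).const_mul (ε : ℂ)
  refine h2.congr_deriv ?_
  rw [circlePath]
  ring

theorem continuous_circlePath (ε : ℝ) : Continuous (circlePath ε) :=
  continuous_iff_continuousAt.2 fun θ => (hasDerivAt_circlePath ε θ).continuousAt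

/-- Averaging over a small circle in the coordinate `i₀` evaluates at the centre; the coordinate
`i₀` of the cube is then free to take the role of the outer variable. -/
theorem integral_smul_integral_circle_eq [CompleteSpace E] (i₀ : Fin N) {ε : ℝ} (hε : 0 < ε)
    (κ : ℝ → ℂ) (h : ℂ → (Fin N → ℝ) → ℝ → E)
    (hindep : ∀ w s t u, h w (Function.update s i₀ t) u = h w s u)
    (hdiff : ∀ s ∈ Icc (0 : Fin N → ℝ) 1, ∀ u ∈ Icc (0 : ℝ) 1,
      DiffContOnCl ℂ (fun w => h w s u) (Metric.ball 0 ε))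
    (hint : ∀ u ∈ Icc (0 : ℝ) 1,
      IntegrableOn (fun s => h (circlePath ε (s i₀)) s u) (Icc (0 : Fin N → ℝ) 1))
    (hint₀ : IntegrableOn (fun s => κ (s i₀) • h 0 s (s i₀)) (Icc (0 : Fin N → ℝ) 1)) :
    ∫ u in (0 : ℝ)..1, κ u • ∫ s in Icc (0 : Fin N → ℝ) 1, h (circlePath ε (s i₀)) s u =
      ∫ s in Icc (0 : Fin N → ℝ) 1, κ (s i₀) • h 0 s (s i₀) := by
  cases N with
  | zero => exact i₀.elim0
  | succ N =>
    have hins : ∀ w (s : Fin N → ℝ) t u,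
        h w (i₀.insertNth t s) u = h w (i₀.insertNth 0 s) u := by
      intro w s t u
      rw [← hindep w (i₀.insertNth 0 s) t u, Fin.update_insertNth]
    -- Slicing the right side with the `i₀` variable outermost identifies that variable with `u`. On
    -- the left the circle variable is integrated innermost, where the mean value property applies.
    rw [setIntegral_cube i₀ hint₀]
    refine intervalIntegral.integral_congr fun u hu => ?_
    rw [uIcc_of_le zero_le_one] at hu
    simp only [Fin.insertNth_apply_same, hins]
    rw [setIntegral_cube_symm i₀ (hint u hu), integral_smul]
    congr 1
    refine setIntegral_congr_fun measurableSet_Icc fun s hs => ?_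
    simp only [Fin.insertNth_apply_same, hins]
    exact integral_circlePath hε
      (hdiff _ ((insertNth_mem_cube_iff i₀ 0 s).2 ⟨by simp, hs⟩) u hu)

end Cube

end TopForm

namespace TopForm

open Matrix

/-! ### The bridged parametrization -/

section Chart

variable {p m n N : ℕ} {a b : Fin n} {a' : Fin p → Fin n} {c : Fin m → Fin n}
  {G : (Fin N → ℂ) → Matrix (Fin (p + m + 1)) (Fin n) ℂ} {i₀ : Fin N} {Ω : Set (Fin N → ℂ)}

/-- Nondegeneracy is inherited through the equality of densities. For the locus, the bridge
parameter of the bridged point is `0 + z i₀`, so undoing the bridge returns to the old chart at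
`z_{i₀} = 0`. -/
theorem isResidueChart_bridgedChart (hN : (p + m + 1) * (p + m + 1) + N = (p + m + 1) * n)
    (hab : a ≠ b) (ha' : ∀ i, a' i ≠ b) {S : Finset (Fin n)} (hcS : ∀ i, c i ∈ S) (haS : a ∉ S)
    (hbS : b ∉ S) {L : Finset (LinRel n)} (hL : (insert b S, m) ∈ L)
    (hLmin : ∀ R ∈ L, b ∈ R.1 → a ∉ R.1 → insert b S ⊆ R.1) {A : Finset (Fin N)} (hi₀ : i₀ ∈ A)
    (hG : IsResidueChart hN L A Ω G)
    (ht : ∀ z ∈ Ω, minor (G z) (cols a a' c) ≠ 0 ∧ bridgeParam a b a' c (G z) = z i₀) :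
    IsResidueChart hN (updateRels a b L) (A.erase i₀) (bridgedDomain i₀ Ω)
      (bridgedChart a b i₀ G) := by
  have hcb : ∀ i, c i ≠ b := fun i h => hbS (h ▸ hcS i)
  refine ⟨?_, fun r j z hz => ?_, fun z hz => ?_, fun z hz => ?_⟩
  · exact hG.isOpen.preimage (continuous_id.update i₀ continuous_const)
  · have h : ∀ r j, AnalyticAt ℂ (fun z => G (Function.update z i₀ 0) r j) z := fun r j =>
      AnalyticAt.comp (g := fun z => G z r j) (f := fun w => Function.update w i₀ 0)
        (hG.holomorphic r j _ hz) (analyticAt_update i₀ z)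
    simp only [bridgedChart, mul_bridge_apply]
    split_ifs
    · exact (h r j).add (((ContinuousLinearMap.proj (R := ℂ)
        (φ := fun _ : Fin N => ℂ) i₀).analyticAt z).mul (h r a))
    · simpa using h r j
  · rw [density_bridgedChart hN hab ha' hcb hG.isOpen
      (fun z hz r j => (hG.holomorphic r j z hz).differentiableAt) ht hz]
    exact hG.nondegenerate _ hz
  · have hz' : Function.update z i₀ 0 ∈ Ω := hz
    obtain ⟨ha, hp⟩ := ht _ hz'
    have hzero : (∀ i ∈ A, Function.update z i₀ 0 i = 0) ↔ ∀ i ∈ A.erase i₀, z i = 0 := by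
      constructor
      · intro h i hi
        have := h i (Finset.mem_of_mem_erase hi)
        rwa [Function.update_of_ne (Finset.ne_of_mem_erase hi)] at this
      · intro h i hi
        by_cases hii : i = i₀
        · subst hii; simp
        · rw [Function.update_of_ne hii]
          exact h i (Finset.mem_erase.2 ⟨hii, hi⟩)
    rw [← hzero, ← hG.mem_locus_iff _ hz']
    constructor
    · intro h
      have hmem := mul_bridge_neg_mem_locus hab ha' hcS haS hbS hL hLmin
        (C := bridgedChart a b i₀ G z)
        (by rwa [bridgedChart, minor_cols_mul_bridge hab ha' hcb]) h
      rwa [bridgedChart, bridgeParam_mul_bridge hab ha' hcb ha, hp, Function.update_self, zero_add,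
        mul_bridge_mul_bridge_neg hab] at hmem
    · exact fun h => mul_bridge_mem_locus_updateRels hab h _

end Chart

/-! ### The residue integrand -/

section Regularity

variable {k n N : ℕ} {X : Type*} [NormedAddCommGroup X] [NormedSpace ℂ X]

theorem differentiableAt_det {ι : Type*} [Fintype ι] [DecidableEq ι] {M : X → Matrix ι ι ℂ} {x : X}
    (hM : ∀ i j, DifferentiableAt ℂ (fun x => M x i j) x) :
    DifferentiableAt ℂ (fun x => (M x).det) x := by
  simp only [det_apply']
  fun_prop

theorem differentiableAt_minor {M : X → Matrix (Fin k) (Fin n) ℂ} {x : X}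
    (hM : ∀ i j, DifferentiableAt ℂ (fun x => M x i j) x) (I : Fin k → Fin n) :
    DifferentiableAt ℂ (fun x => minor (M x) I) x :=
  differentiableAt_det fun i j => hM i (I j)

theorem differentiableAt_eval_minor {M : X → Matrix (Fin k) (Fin n) ℂ} {x : X}
    (hM : ∀ i j, DifferentiableAt ℂ (fun x => M x i j) x)
    (P : MvPolynomial (Fin k → Fin n) ℂ) :
    DifferentiableAt ℂ (fun x => MvPolynomial.eval (minor (M x)) P) x := by
  have h := differentiableAt_minor hM
  simp only [MvPolynomial.eval_eq']
  fun_prop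

theorem differentiableAt_density (hN : k * k + N = k * n)
    {G : (Fin N → ℂ) → Matrix (Fin k) (Fin n) ℂ} {z : Fin N → ℂ}
    (hG : ∀ r j, AnalyticAt ℂ (fun z => G z r j) z) :
    DifferentiableAt ℂ (density hN G) z := by
  have hG' : ∀ i r j, DifferentiableAt ℂ (fun z => partialDeriv G i z r j) z := fun i r j =>
    (hG r j).fderiv.differentiableAt.clm_apply (differentiableAt_const _)
  change DifferentiableAt ℂ (fun z => (vecMatrix finProdFinEquiv (grassmannEquiv hN)
      (Sum.elim (fun ij : Fin k × Fin k => Matrix.single ij.1 ij.2 (1 : ℂ) * G z)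
        fun i => partialDeriv G i z)).det) z
  refine differentiableAt_det fun x y => ?_
  obtain ⟨y, rfl⟩ := (grassmannEquiv hN).surjective y
  simp only [vecMatrix, of_apply, Equiv.symm_apply_apply]
  rcases y with y | y
  · have hG₀ := fun r j => (hG r j).differentiableAt
    simp only [Sum.elim_inl, Matrix.mul_apply]
    fun_prop
  · exact hG' y _ _

theorem differentiableAt_comp_matrix {E : Type*} [NormedAddCommGroup E] [NormedSpace ℂ E]
    {M : X → Matrix (Fin k) (Fin n) ℂ} {x : X}
    (hM : ∀ i j, DifferentiableAt ℂ (fun x => M x i j) x) {U : Set (Matrix (Fin k) (Fin n) ℂ)}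
    {φ : Matrix (Fin k) (Fin n) ℂ → E} (hU : IsOpen U) (hφ : DifferentiableOn ℂ φ U)
    (hx : M x ∈ U) : DifferentiableAt ℂ (fun x => φ (M x)) x := by
  let ψ : (Fin k → Fin n → ℂ) → E := φ
  have hψ : DifferentiableAt ℂ ψ (M x) := by
    have hφ' : DifferentiableOn ℂ ψ (U : Set (Fin k → Fin n → ℂ)) := hφ
    have hU' : @IsOpen (Fin k → Fin n → ℂ) _ U := hU
    exact hφ'.differentiableAt (hU'.mem_nhds hx)
  let M' : X → Fin k → Fin n → ℂ := M
  have hM' : DifferentiableAt ℂ M' x :=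
    differentiableAt_pi.2 fun i => differentiableAt_pi.2 fun j => hM i j
  exact DifferentiableAt.comp x (g := ψ) (f := M') hψ hM'

theorem differentiableAt_mul_bridge {M : X → Matrix (Fin k) (Fin n) ℂ} {β : X → ℂ} {x : X}
    (hM : ∀ i j, DifferentiableAt ℂ (fun x => M x i j) x) (hβ : DifferentiableAt ℂ β x)
    (a b : Fin n) (i : Fin k) (j : Fin n) :
    DifferentiableAt ℂ (fun x => (M x * bridge a b (β x)) i j) x := by
  simp only [mul_bridge_apply]
  split_ifs <;> fun_prop

end Regularity

section Residue

variable {p m n N w : ℕ} {E : Type*} [NormedAddCommGroup E] [NormedSpace ℂ E]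

/-- The residue of the top-form integrand at `t_{1,b} = 0`, extended to a neighbourhood, as a
function of the coordinates and of the bridge parameter. -/
noncomputable def residueIntegrand (hN : (p + m + 1) * (p + m + 1) + N = (p + m + 1) * n) (a b : Fin n)
    (a' : Fin p → Fin n) (c : Fin m → Fin n) (fbar : MinorFun (p + m + 1) n w)
    (G : (Fin N → ℂ) → Matrix (Fin (p + m + 1)) (Fin n) ℂ)
    (φ : Matrix (Fin (p + m + 1)) (Fin n) ℂ → E) (x : (Fin N → ℂ) × ℂ) : E :=
  (MvPolynomial.eval (minor (G x.1)) fbar.den /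
    (minor (G x.1) (cols a a' c) * MvPolynomial.eval (minor (G x.1)) fbar.num) *
      density hN G x.1) • φ (G x.1 * bridge a b x.2)

/-- The points at which `residueIntegrand` is holomorphic. -/
noncomputable def residueDomain (a b : Fin n) (fbar : MinorFun (p + m + 1) n w) (Ω : Set (Fin N → ℂ))
    (G : (Fin N → ℂ) → Matrix (Fin (p + m + 1)) (Fin n) ℂ)
    (U : Set (Matrix (Fin (p + m + 1)) (Fin n) ℂ)) : Set ((Fin N → ℂ) × ℂ) :=
  {x | x.1 ∈ Ω ∧ MvPolynomial.eval (minor (G x.1)) fbar.num ≠ 0 ∧ G x.1 * bridge a b x.2 ∈ U}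

variable {a b : Fin n} {a' : Fin p → Fin n} {c : Fin m → Fin n}
  {hN : (p + m + 1) * (p + m + 1) + N = (p + m + 1) * n} {fbar : MinorFun (p + m + 1) n w}
  {Ω : Set (Fin N → ℂ)} {G : (Fin N → ℂ) → Matrix (Fin (p + m + 1)) (Fin n) ℂ}
  {U : Set (Matrix (Fin (p + m + 1)) (Fin n) ℂ)} {φ : Matrix (Fin (p + m + 1)) (Fin n) ℂ → E}

theorem isOpen_residueDomain (hΩ : IsOpen Ω)
    (hG : ∀ r j, AnalyticOnNhd ℂ (fun z => G z r j) Ω) (hU : IsOpen U) :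
    IsOpen (residueDomain a b fbar Ω G U) := by
  refine isOpen_iff_eventually.2 fun x hx => ?_
  obtain ⟨h1, h2, h3⟩ := hx
  have hd : ∀ r j, DifferentiableAt ℂ (fun x : (Fin N → ℂ) × ℂ => G x.1 r j) x := fun r j =>
    DifferentiableAt.comp x (g := fun z => G z r j) (hG r j x.1 h1).differentiableAt
      differentiableAt_fst
  have hm : ContinuousAt (fun x : (Fin N → ℂ) × ℂ => G x.1 * bridge a b x.2) x :=
    continuousAt_pi.2 fun r => continuousAt_pi.2 fun j =>
      (differentiableAt_mul_bridge hd differentiableAt_snd a b r j).continuousAt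
  filter_upwards [continuousAt_fst.preimage_mem_nhds (hΩ.mem_nhds h1),
    (differentiableAt_eval_minor hd fbar.num).continuousAt.eventually_ne h2,
    hm.preimage_mem_nhds (hU.mem_nhds h3)] with y hy1 hy2 hy3
  exact ⟨hy1, hy2, hy3⟩

/-- The denominator of `f̄` stands in the numerator here, so only the zeros of `fbar.num` have to be
avoided. -/
theorem differentiableAt_residueIntegrand
    (hG : ∀ r j, AnalyticOnNhd ℂ (fun z => G z r j) Ω)
    (ha : ∀ z ∈ Ω, minor (G z) (cols a a' c) ≠ 0) (hU : IsOpen U) (hφ : DifferentiableOn ℂ φ U)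
    {x : (Fin N → ℂ) × ℂ} (hx : x ∈ residueDomain a b fbar Ω G U) :
    DifferentiableAt ℂ (residueIntegrand hN a b a' c fbar G φ) x := by
  obtain ⟨h1, h2, h3⟩ := hx
  have hd : ∀ r j, DifferentiableAt ℂ (fun x : (Fin N → ℂ) × ℂ => G x.1 r j) x := fun r j =>
    DifferentiableAt.comp x (g := fun z => G z r j) (hG r j x.1 h1).differentiableAt
      differentiableAt_fst
  have hdens : DifferentiableAt ℂ (fun x : (Fin N → ℂ) × ℂ => density hN G x.1) x :=
    DifferentiableAt.comp x (g := density hN G) (differentiableAt_density hN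
      fun r j => hG r j x.1 h1) differentiableAt_fst
  have hdiv : DifferentiableAt ℂ (fun x : (Fin N → ℂ) × ℂ =>
      MvPolynomial.eval (minor (G x.1)) fbar.den /
        (minor (G x.1) (cols a a' c) * MvPolynomial.eval (minor (G x.1)) fbar.num)) x := by
    have hden := differentiableAt_eval_minor hd fbar.den
    have hmul := (differentiableAt_minor hd (cols a a' c)).fun_mul
      (differentiableAt_eval_minor hd fbar.num)
    simp only [div_eq_mul_inv]
    exact hden.fun_mul (hmul.fun_inv (mul_ne_zero (ha _ h1) h2))
  exact (hdiv.fun_mul hdens).fun_smul (differentiableAt_comp_matrix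
    (differentiableAt_mul_bridge hd differentiableAt_snd a b) hU hφ h3)

end Residue

end TopForm

namespace TopForm

open Matrix MeasureTheory Set

/-! ### The residue at `t_{1,b} = 0` and the comparison of the integrals -/

section Bridge

variable {p m n N : ℕ} {E : Type*} [NormedAddCommGroup E] [NormedSpace ℂ E]
  {a b : Fin n} {a' : Fin p → Fin n} {c : Fin m → Fin n}
  {hN : (p + m + 1) * (p + m + 1) + N = (p + m + 1) * n}
  {Ω : Set (Fin N → ℂ)} {G : (Fin N → ℂ) → Matrix (Fin (p + m + 1)) (Fin n) ℂ} {i₀ : Fin N}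
  {U : Set (Matrix (Fin (p + m + 1)) (Fin n) ℂ)} {φ : Matrix (Fin (p + m + 1)) (Fin n) ℂ → E}

/-- The point of the contour with parameters `s`, with the coordinate `i₀` replaced by `w`. -/
def contourPoint (γ : Fin N → ℝ → ℂ) (i₀ : Fin N) (w : ℂ) (s : Fin N → ℝ) : Fin N → ℂ :=
  Function.update (fun i => γ i (s i)) i₀ w

theorem contourPoint_update_left (γ : Fin N → ℝ → ℂ) (i₀ : Fin N) (w w' : ℂ) (s : Fin N → ℝ) :
    Function.update (contourPoint γ i₀ w s) i₀ w' = contourPoint γ i₀ w' s := by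
  simp [contourPoint]

theorem contourPoint_self (γ : Fin N → ℝ → ℂ) (i₀ : Fin N) (w : ℂ) (s : Fin N → ℝ) :
    contourPoint γ i₀ w s i₀ = w := by
  simp [contourPoint]

theorem contourPoint_update_right (γ : Fin N → ℝ → ℂ) (i₀ : Fin N) (w : ℂ) (s : Fin N → ℝ)
    (t : ℝ) : contourPoint γ i₀ w (Function.update s i₀ t) = contourPoint γ i₀ w s := by
  ext i
  by_cases h : i = i₀
  · subst h; simp [contourPoint]
  · simp [contourPoint, h]

theorem update_path_apply (γ : Fin N → ℝ → ℂ) (i₀ : Fin N) (σ : ℝ → ℂ) (s : Fin N → ℝ) :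
    (fun i => Function.update γ i₀ σ i (s i)) = contourPoint γ i₀ (σ (s i₀)) s := by
  ext i
  by_cases h : i = i₀
  · subst h; simp [contourPoint]
  · simp [contourPoint, h]

theorem continuous_contourPoint {γ : Fin N → ℝ → ℂ} (hγ : ∀ i, i ≠ i₀ → Continuous (γ i)) :
    Continuous fun x : ℂ × (Fin N → ℝ) => contourPoint γ i₀ x.1 x.2 := by
  refine continuous_pi fun i => ?_
  by_cases h : i = i₀
  · subst h
    simpa [contourPoint] using continuous_fst
  · simp only [contourPoint, Function.update_of_ne h]
    exact (hγ i h).comp ((continuous_apply i).comp continuous_snd)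

theorem differentiable_contourPoint (γ : Fin N → ℝ → ℂ) (i₀ : Fin N) (s : Fin N → ℝ) :
    Differentiable ℂ fun w => contourPoint γ i₀ w s := by
  refine differentiable_pi.2 fun i => ?_
  by_cases h : i = i₀
  · subst h
    simp [contourPoint]
  · simp [contourPoint, h]

/-- The product of the velocities of the coordinates other than `i₀`. -/
noncomputable def velocity (γ : Fin N → ℝ → ℂ) (i₀ : Fin N) (s : Fin N → ℝ) : ℂ :=
  ∏ i ∈ Finset.univ.erase i₀, deriv (γ i) (s i)

theorem velocity_update (γ : Fin N → ℝ → ℂ) (i₀ : Fin N) (s : Fin N → ℝ) (t : ℝ) :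
    velocity γ i₀ (Function.update s i₀ t) = velocity γ i₀ s :=
  Finset.prod_congr rfl fun i hi => by rw [Function.update_of_ne (Finset.ne_of_mem_erase hi)]

theorem continuous_velocity {γ : Fin N → ℝ → ℂ} (hγ : ∀ i, i ≠ i₀ → ContDiff ℝ 1 (γ i)) :
    Continuous (velocity γ i₀) :=
  continuous_finsetProd _ fun i hi =>
    ((hγ i (Finset.ne_of_mem_erase hi)).continuous_deriv le_rfl).comp (continuous_apply i)

theorem prod_deriv_update_path (γ : Fin N → ℝ → ℂ) (i₀ : Fin N) (σ : ℝ → ℂ) (s : Fin N → ℝ) :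
    ∏ i, deriv (Function.update γ i₀ σ i) (s i) = deriv σ (s i₀) * velocity γ i₀ s := by
  rw [← Finset.mul_prod_erase _ _ (Finset.mem_univ i₀), Function.update_self, velocity]
  congr 1
  exact Finset.prod_congr rfl fun i hi => by rw [Function.update_of_ne (Finset.ne_of_mem_erase hi)]

/-- On the chart `f = w (a, a₂ … c_m) f̄` with `w = z_{i₀}`, and the velocity `2πi w` of the circle
cancels the pole. -/
theorem topFormIntegrand_circlePath {f : MinorFun (p + m + 1) n n}
    {fbar : MinorFun (p + m + 1) n (n - 1)}
    (hf : ∀ C, minor C (cols b a' c) ≠ 0 → fbar.val C = f.val C / minor C (cols b a' c))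
    (ht : ∀ z ∈ Ω, minor (G z) (cols a a' c) ≠ 0 ∧ bridgeParam a b a' c (G z) = z i₀)
    (γ : Fin N → ℝ → ℂ) {ε : ℝ} (hε : 0 < ε) (β : ℂ) {s : Fin N → ℝ}
    (hs : (contourPoint γ i₀ (circlePath ε (s i₀)) s, β) ∈ residueDomain a b fbar Ω G U) :
    topFormIntegrand hN G (Function.update γ i₀ (circlePath ε)) f.val
        (fun C => φ (C * bridge a b β)) s =
      (2 * Real.pi * Complex.I : ℂ) • velocity γ i₀ s •
        residueIntegrand hN a b a' c fbar G φ
          (contourPoint γ i₀ (circlePath ε (s i₀)) s, β) := by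
  set w := circlePath ε (s i₀) with hw
  set z := contourPoint γ i₀ w s with hz
  have hzΩ : z ∈ Ω := hs.1
  have hnum : MvPolynomial.eval (minor (G z)) fbar.num ≠ 0 := hs.2.1
  have hw0 : w ≠ 0 := by
    rw [← norm_pos_iff, hw, norm_circlePath hε]
    exact hε
  have ha := (ht z hzΩ).1
  have hb : minor (G z) (cols b a' c) = w * minor (G z) (cols a a' c) := by
    rw [minor_cols_chart ht hzΩ, hz, contourPoint_self]
  have hfz : f.val (G z) = w * minor (G z) (cols a a' c) * (MvPolynomial.eval (minor (G z)) fbar.num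
      / MvPolynomial.eval (minor (G z)) fbar.den) := by
    have hb0 : minor (G z) (cols b a' c) ≠ 0 := hb ▸ mul_ne_zero hw0 ha
    rw [← hb, mul_comm, ← div_eq_iff hb0, ← hf _ hb0]
    rfl
  rw [topFormIntegrand, update_path_apply, prod_deriv_update_path,
    (hasDerivAt_circlePath ε (s i₀)).deriv, ← hw, ← hz, residueIntegrand, smul_smul, smul_smul, hfz]
  congr 1
  dsimp only
  -- Inverting the quotient needs no assumption on `fbar.den`: where it vanishes, the convention `x
  -- / 0 = 0` makes both sides zero.
  rw [one_div, mul_inv, inv_div]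
  field_simp

/-- The same function `residueIntegrand` now appears at `w = 0`, with weight `dα / α` because `(b̂,
a₂ … c_m) = α (a, a₂ … c_m)`. -/
theorem topFormIntegrand_bridgedChart {fbar : MinorFun (p + m + 1) n (n - 1)}
    (hab : a ≠ b) (ha' : ∀ i, a' i ≠ b) (hc : ∀ i, c i ≠ b) (hΩ : IsOpen Ω)
    (hG : ∀ z ∈ Ω, ∀ r j, DifferentiableAt ℂ (fun z => G z r j) z)
    (ht : ∀ z ∈ Ω, minor (G z) (cols a a' c) ≠ 0 ∧ bridgeParam a b a' c (G z) = z i₀)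
    (γ : Fin N → ℝ → ℂ) {q : ℝ → ℂ} {s : Fin N → ℝ} (hq : q (s i₀) ≠ 0)
    (hs : (contourPoint γ i₀ 0 s, q (s i₀)) ∈ residueDomain a b fbar Ω G U) :
    topFormIntegrand hN (bridgedChart a b i₀ G) (Function.update γ i₀ q)
        (bridgedFun a b a' c fbar) φ s =
      (deriv q (s i₀) / q (s i₀)) • velocity γ i₀ s •
        residueIntegrand hN a b a' c fbar G φ (contourPoint γ i₀ 0 s, q (s i₀)) := by
  have hzΩ : contourPoint γ i₀ 0 s ∈ Ω := hs.1
  have hnum : MvPolynomial.eval (minor (G (contourPoint γ i₀ 0 s))) fbar.num ≠ 0 := hs.2.1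
  have hz := contourPoint_update_left γ i₀ (q (s i₀)) 0 s
  have ha := (ht _ hzΩ).1
  have hb : minor (G (contourPoint γ i₀ 0 s)) (cols b a' c) = 0 := by
    rw [minor_cols_chart ht hzΩ, contourPoint_self, zero_mul]
  have hchart : bridgedChart a b i₀ G (contourPoint γ i₀ (q (s i₀)) s) =
      G (contourPoint γ i₀ 0 s) * bridge a b (q (s i₀)) := by
    rw [bridgedChart, hz, contourPoint_self]
  rw [topFormIntegrand, update_path_apply, prod_deriv_update_path,
    density_bridgedChart hN hab ha' hc hΩ hG ht (hz ▸ hzΩ), hz, hchart,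
    bridgedFun_mul_bridge hab ha' hc fbar ha hb, residueIntegrand, smul_smul, smul_smul]
  congr 1
  dsimp only
  rw [MinorFun.val, MinorFun.subst, one_div, mul_inv _ (_ / _), inv_div]
  field_simp

/-- The tube lemma: an open condition holding at `w = 0` for all parameters in a compact set
persists for all small `w` uniformly. This is where the bound on the radius comes from. -/
theorem exists_pos_forall_mem_residueDomain {fbar : MinorFun (p + m + 1) n (n - 1)}
    (hΩ : IsOpen Ω) (hG : ∀ r j, AnalyticOnNhd ℂ (fun z => G z r j) Ω) (hU : IsOpen U)
    {γ : Fin N → ℝ → ℂ} (hγ : ∀ i, i ≠ i₀ → Continuous (γ i)) {q : ℝ → ℂ} (hq : Continuous q)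
    (h : ∀ s ∈ Icc (0 : Fin N → ℝ) 1, ∀ u ∈ Icc (0 : ℝ) 1,
      (contourPoint γ i₀ 0 s, q u) ∈ residueDomain a b fbar Ω G U) :
    ∃ ε₀ : ℝ, 0 < ε₀ ∧ ∀ w : ℂ, ‖w‖ < ε₀ → ∀ s ∈ Icc (0 : Fin N → ℝ) 1, ∀ u ∈ Icc (0 : ℝ) 1,
      (contourPoint γ i₀ w s, q u) ∈ residueDomain a b fbar Ω G U := by
  have hK : IsCompact (Icc (0 : Fin N → ℝ) 1 ×ˢ Icc (0 : ℝ) 1) := isCompact_Icc.prod isCompact_Icc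
  have hcont : Continuous fun x : ℂ × (Fin N → ℝ) × ℝ =>
      (contourPoint γ i₀ x.1 x.2.1, q x.2.2) := by
    refine Continuous.prodMk ?_ (hq.comp (continuous_snd.comp continuous_snd))
    exact (continuous_contourPoint hγ).comp
      (continuous_fst.prodMk (continuous_fst.comp continuous_snd))
  have hev := hK.eventually_forall_of_forall_eventually (x₀ := (0 : ℂ))
    (P := fun w y => (contourPoint γ i₀ w y.1, q y.2) ∈ residueDomain a b fbar Ω G U)
    fun y hy => hcont.continuousAt.preimage_mem_nhds
      ((isOpen_residueDomain hΩ hG hU).mem_nhds (h y.1 hy.1 y.2 hy.2))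
  obtain ⟨ε₀, hε₀, hball⟩ := Metric.eventually_nhds_iff.1 hev
  exact ⟨ε₀, hε₀, fun w hw s hs u hu => hball (by rwa [dist_zero_right]) (s, u) ⟨hs, hu⟩⟩

theorem integrableOn_cube_residueIntegrand {fbar : MinorFun (p + m + 1) n (n - 1)}
    (hG : ∀ r j, AnalyticOnNhd ℂ (fun z => G z r j) Ω)
    (ha : ∀ z ∈ Ω, minor (G z) (cols a a' c) ≠ 0) (hU : IsOpen U) (hφ : DifferentiableOn ℂ φ U)
    {γ : Fin N → ℝ → ℂ} (hγ : ∀ i, i ≠ i₀ → ContDiff ℝ 1 (γ i))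
    {κ : (Fin N → ℝ) → ℂ} (hκ : ContinuousOn κ (Icc 0 1))
    {σ β : (Fin N → ℝ) → ℂ} (hσ : Continuous σ) (hβ : Continuous β)
    (h : ∀ s ∈ Icc (0 : Fin N → ℝ) 1,
      (contourPoint γ i₀ (σ s) s, β s) ∈ residueDomain a b fbar Ω G U) :
    IntegrableOn (fun s => κ s • velocity γ i₀ s • residueIntegrand hN a b a' c fbar G φ
      (contourPoint γ i₀ (σ s) s, β s)) (Icc 0 1) := by
  refine ContinuousOn.integrableOn_compact isCompact_Icc ?_
  refine hκ.smul ((continuous_velocity hγ).continuousOn.smul fun s hs => ?_)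
  have hcont : Continuous fun s => (contourPoint γ i₀ (σ s) s, β s) :=
    ((continuous_contourPoint fun i hi => (hγ i hi).continuous).comp
      (hσ.prodMk continuous_id)).prodMk hβ
  exact (ContinuousAt.comp (f := fun s => (contourPoint γ i₀ (σ s) s, β s)) (x := s)
    (g := residueIntegrand hN a b a' c fbar G φ)
    (differentiableAt_residueIntegrand hG ha hU hφ (h s hs)).continuousAt
    hcont.continuousAt).continuousWithinAt

theorem attachBridge_eq_topForm [CompleteSpace E] {L : Finset (LinRel n)} {A : Finset (Fin N)}
    (hi₀ : i₀ ∈ A) {f : MinorFun (p + m + 1) n n} {fbar : MinorFun (p + m + 1) n (n - 1)}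
    (hab : a ≠ b) (ha' : ∀ i, a' i ≠ b) (hc : ∀ i, c i ≠ b)
    (hf : ∀ C, minor C (cols b a' c) ≠ 0 → fbar.val C = f.val C / minor C (cols b a' c))
    (hG : IsResidueChart hN L A Ω G)
    (ht : ∀ z ∈ Ω, minor (G z) (cols a a' c) ≠ 0 ∧ bridgeParam a b a' c (G z) = z i₀)
    {γ : Fin N → ℝ → ℂ} (hγ : ∀ i, i ≠ i₀ → ContDiff ℝ 1 (γ i))
    {q : ℝ → ℂ} (hq : ContDiff ℝ 1 q) (hq0 : ∀ u ∈ Icc (0 : ℝ) 1, q u ≠ 0)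
    (hU : IsOpen U) (hφ : DifferentiableOn ℂ φ U)
    (h : ∀ s ∈ Icc (0 : Fin N → ℝ) 1, ∀ u ∈ Icc (0 : ℝ) 1,
      (contourPoint γ i₀ 0 s, q u) ∈ residueDomain a b fbar Ω G U) :
    IntegrableOn (topFormIntegrand hN (bridgedChart a b i₀ G) (Function.update γ i₀ q)
      (bridgedFun a b a' c fbar) φ) (Icc 0 1) ∧
    ∃ ε₀ : ℝ, 0 < ε₀ ∧ ∀ ε : ℝ, 0 < ε → ε < ε₀ →
      (∀ u ∈ Icc (0 : ℝ) 1, IntegrableOn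
        (topFormIntegrand hN G (Function.update γ i₀ (circlePath ε)) f.val
          (fun C => φ (C * bridge a b (q u)))) (Icc 0 1)) ∧
      attachBridge hN A G (Function.update γ i₀ (circlePath ε)) f.val φ a b q =
        topForm hN (A.erase i₀) (bridgedChart a b i₀ G) (Function.update γ i₀ q)
          (bridgedFun a b a' c fbar) φ := by
  have hmaps : ∀ s ∈ Icc (0 : Fin N → ℝ) 1, s i₀ ∈ Icc (0 : ℝ) 1 := fun s hs =>
    ⟨hs.1 i₀, hs.2 i₀⟩
  have ha : ∀ z ∈ Ω, minor (G z) (cols a a' c) ≠ 0 := fun z hz => (ht z hz).1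
  have hhat : EqOn (topFormIntegrand hN (bridgedChart a b i₀ G) (Function.update γ i₀ q)
      (bridgedFun a b a' c fbar) φ) (fun s => (deriv q (s i₀) / q (s i₀)) • velocity γ i₀ s •
        residueIntegrand hN a b a' c fbar G φ (contourPoint γ i₀ 0 s, q (s i₀))) (Icc 0 1) :=
    fun s hs => topFormIntegrand_bridgedChart hab ha' hc hG.isOpen
      (fun z hz r j => (hG.holomorphic r j z hz).differentiableAt) ht γ
      (hq0 _ (hmaps s hs)) (h s hs _ (hmaps s hs))
  have hκ : ContinuousOn (fun s : Fin N → ℝ => deriv q (s i₀) / q (s i₀)) (Icc 0 1) :=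
    (((hq.continuous_deriv le_rfl).comp (continuous_apply i₀)).continuousOn).div
      ((hq.continuous.comp (continuous_apply i₀)).continuousOn) fun s hs => hq0 _ (hmaps s hs)
  have hint₀ := integrableOn_cube_residueIntegrand (hN := hN) hG.holomorphic ha hU hφ hγ hκ
    continuous_const (hq.continuous.comp (continuous_apply i₀)) fun s hs => h s hs _ (hmaps s hs)
  refine ⟨hint₀.congr_fun hhat.symm measurableSet_Icc, ?_⟩
  obtain ⟨ε₀, hε₀, hdom⟩ := exists_pos_forall_mem_residueDomain hG.isOpen hG.holomorphic hU
    (fun i hi => (hγ i hi).continuous) hq.continuous h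
  refine ⟨ε₀, hε₀, fun ε hε hεε₀ => ?_⟩
  have hcirc : ∀ s ∈ Icc (0 : Fin N → ℝ) 1, ∀ u ∈ Icc (0 : ℝ) 1,
      (contourPoint γ i₀ (circlePath ε (s i₀)) s, q u) ∈ residueDomain a b fbar Ω G U :=
    fun s hs u hu => hdom _ (by rwa [norm_circlePath hε]) s hs u hu
  have horig : ∀ u ∈ Icc (0 : ℝ) 1, EqOn
      (topFormIntegrand hN G (Function.update γ i₀ (circlePath ε)) f.val
        (fun C => φ (C * bridge a b (q u))))
      (fun s => (2 * Real.pi * Complex.I : ℂ) • velocity γ i₀ s •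
        residueIntegrand hN a b a' c fbar G φ
          (contourPoint γ i₀ (circlePath ε (s i₀)) s, q u)) (Icc 0 1) :=
    fun u hu s hs => topFormIntegrand_circlePath hf ht γ hε (q u) (hcirc s hs u hu)
  have hint : ∀ (κ : ℂ), ∀ u ∈ Icc (0 : ℝ) 1, IntegrableOn (fun s => κ • velocity γ i₀ s •
      residueIntegrand hN a b a' c fbar G φ
        (contourPoint γ i₀ (circlePath ε (s i₀)) s, q u)) (Icc 0 1) := fun κ u hu =>
    integrableOn_cube_residueIntegrand hG.holomorphic ha hU hφ hγ continuousOn_const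
      ((continuous_circlePath ε).comp (continuous_apply i₀)) continuous_const
      fun s hs => hcirc s hs u hu
  refine ⟨fun u hu => (hint _ u hu).congr_fun (horig u hu).symm measurableSet_Icc, ?_⟩
  -- The integrand `h` does not depend on the parameter `s i₀`: the velocity omits that coordinate
  -- and `contourPoint` overwrites it by `w`.
  have key := integral_smul_integral_circle_eq i₀ hε (fun u => deriv q u / q u)
    (fun w s u => velocity γ i₀ s • residueIntegrand hN a b a' c fbar G φ
      (contourPoint γ i₀ w s, q u))
    (fun w s t u => by rw [velocity_update, contourPoint_update_right])
    (fun s hs u hu => by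
      refine DifferentiableOn.diffContOnCl fun w hw => ?_
      have hw' : ‖w‖ ≤ ε := by
        rw [closure_ball _ hε.ne'] at hw
        simpa using hw
      have hd := differentiableAt_residueIntegrand (hN := hN) hG.holomorphic ha hU hφ
        (hdom w (hw'.trans_lt hεε₀) s hs u hu)
      exact ((hd.comp w (f := fun w => (contourPoint γ i₀ w s, q u))
        ((differentiable_contourPoint γ i₀ s w).prodMk
          (differentiableAt_const _))).const_smul _).differentiableWithinAt)
    (fun u hu => by simpa using hint 1 u hu) hint₀
  -- The `2πi` from the velocity of the circle uses up one normalization factor, matching the drop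
  -- in codimension from `A` to `A.erase i₀`.
  have hcard : ((2 * Real.pi * Complex.I : ℂ) ^ A.card)⁻¹ * (2 * Real.pi * Complex.I) =
      ((2 * Real.pi * Complex.I : ℂ) ^ (A.erase i₀).card)⁻¹ := by
    rw [← Finset.card_erase_add_one hi₀, pow_succ, mul_inv, mul_assoc,
      inv_mul_cancel₀ Complex.two_pi_I_ne_zero, mul_one]
  rw [topForm, setIntegral_congr_fun measurableSet_Icc hhat, ← key, ← hcard, attachBridge,
    ← intervalIntegral.integral_smul]
  refine intervalIntegral.integral_congr fun u hu => ?_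
  rw [uIcc_of_le zero_le_one] at hu
  simp only [topForm]
  rw [setIntegral_congr_fun measurableSet_Icc (horig u hu), integral_smul, smul_smul,
    smul_smul, smul_smul]
  congr 1
  ring

end Bridge

end TopForm

theorem mainTheorem4 {p m n N : ℕ}
    (hN : (p + m + 1) * (p + m + 1) + N = (p + m + 1) * n)
    -- the columns `a`, `b`, `a₂ … a_{k-m}`, `c₁ … c_m`, and the set `S` of all `c₁ … c_s`
    (a b : Fin n) (hab : a ≠ b) (a' : Fin p → Fin n) (c : Fin m → Fin n) (S : Finset (Fin n))
    (hcS : ∀ i, c i ∈ S) (haS : a ∉ S) (hbS : b ∉ S) (hba' : ∀ i, a' i ≠ b)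
    -- the relations describing `Γ`; `(b, c₁ … c_s)^m` is the one altered by the bridge
    (L : Finset (TopForm.LinRel n)) (hL : (insert b S, m) ∈ L)
    (hLmin : ∀ R ∈ L, b ∈ R.1 → a ∉ R.1 → insert b S ⊆ R.1)
    -- the integrand: `f̄ = f / (b, a₂ … a_{k-m}, c₁ … c_m)`, where `1 / f` has a simple pole
    (f : TopForm.MinorFun (p + m + 1) n n) (fbar : TopForm.MinorFun (p + m + 1) n (n - 1))
    (hf : ∀ C, TopForm.minor C (TopForm.cols b a' c) ≠ 0 →
      fbar.val C = f.val C / TopForm.minor C (TopForm.cols b a' c))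
    (hpole : ∃ C, TopForm.minor C (TopForm.cols a a' c) ≠ 0 ∧
      TopForm.minor C (TopForm.cols b a' c) = 0 ∧
      MvPolynomial.eval (TopForm.minor C) fbar.num ≠ 0 ∧
      MvPolynomial.eval (TopForm.minor C) fbar.den ≠ 0) :
    -- `Γ̂`, given by the updated relations, consists of the matrices `C B(a, b; α)` with `C ∈ Γ`
    (TopForm.locus (p + m + 1) (TopForm.updateRels a b L) ∩
        {C | TopForm.minor C (TopForm.cols a a' c) ≠ 0} =
      {D | ∃ C ∈ TopForm.locus (p + m + 1) L, TopForm.minor C (TopForm.cols a a' c) ≠ 0 ∧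
        ∃ α : ℂ, D = C * TopForm.bridge a b α}) ∧
    -- `α` is a ratio of minors of `Ĉ`, and the minors of `C` are expressed by those of `Ĉ`
    (∀ C ∈ TopForm.locus (p + m + 1) L, TopForm.minor C (TopForm.cols a a' c) ≠ 0 → ∀ α : ℂ,
      TopForm.bridgeParam a b a' c (C * TopForm.bridge a b α) = α ∧
      ∀ I, TopForm.minor C I = TopForm.rewriteMinor a b α (C * TopForm.bridge a b α) I) ∧
    -- the new integrand is again a rational function of the minors with the right scaling
    (∃ fhat : TopForm.MinorFun (p + m + 1) n n,
      ∀ C, TopForm.minor C (TopForm.cols a a' c) ≠ 0 →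
        fhat.val C = TopForm.bridgedFun a b a' c fbar C) ∧
    -- the top-form after attaching the bridge
    (∀ (A : Finset (Fin N)) (i₀ : Fin N), i₀ ∈ A →
      ∀ (Ω : Set (Fin N → ℂ)) (G : (Fin N → ℂ) → Matrix (Fin (p + m + 1)) (Fin n) ℂ),
      TopForm.IsResidueChart hN L A Ω G →
      -- the coordinate `i₀` is `t_{1,b}`
      (∀ z ∈ Ω, TopForm.minor (G z) (TopForm.cols a a' c) ≠ 0 ∧
        TopForm.bridgeParam a b a' c (G z) = z i₀) →
      TopForm.IsResidueChart hN (TopForm.updateRels a b L) (A.erase i₀)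
        (TopForm.bridgedDomain i₀ Ω) (TopForm.bridgedChart a b i₀ G) ∧
      ∀ (γ : Fin N → ℝ → ℂ), (∀ i, i ≠ i₀ → ContDiff ℝ 1 (γ i)) →
      (∀ i ∈ A, i ≠ i₀ → ∃ r : ℝ, 0 < r ∧ γ i = TopForm.circlePath r) →
      ∀ (q : ℝ → ℂ), ContDiff ℝ 1 q → (∀ u ∈ Set.Icc (0 : ℝ) 1, q u ≠ 0) →
      ∀ (E : Type*) [NormedAddCommGroup E] [NormedSpace ℂ E] [CompleteSpace E]
        (U : Set (Matrix (Fin (p + m + 1)) (Fin n) ℂ)) (φ : Matrix (Fin (p + m + 1)) (Fin n) ℂ → E),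
      IsOpen U → DifferentiableOn ℂ φ U →
      -- the contour at `t_{1,b} = 0` stays in the domain and meets no further pole
      (∀ s ∈ Set.Icc (0 : Fin N → ℝ) 1,
        Function.update (fun i => γ i (s i)) i₀ 0 ∈ Ω ∧
        MvPolynomial.eval (TopForm.minor (G (Function.update (fun i => γ i (s i)) i₀ 0)))
          fbar.num ≠ 0 ∧
        ∀ u ∈ Set.Icc (0 : ℝ) 1,
          G (Function.update (fun i => γ i (s i)) i₀ 0) * TopForm.bridge a b (q u) ∈ U) →
      MeasureTheory.IntegrableOn
        (TopForm.topFormIntegrand hN (TopForm.bridgedChart a b i₀ G) (Function.update γ i₀ q)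
          (TopForm.bridgedFun a b a' c fbar) φ) (Set.Icc 0 1) ∧
      ∃ ε₀ : ℝ, 0 < ε₀ ∧ ∀ ε : ℝ, 0 < ε → ε < ε₀ →
        (∀ u ∈ Set.Icc (0 : ℝ) 1, MeasureTheory.IntegrableOn
          (TopForm.topFormIntegrand hN G (Function.update γ i₀ (TopForm.circlePath ε)) f.val
            (fun C => φ (C * TopForm.bridge a b (q u)))) (Set.Icc 0 1)) ∧
        TopForm.attachBridge hN A G (Function.update γ i₀ (TopForm.circlePath ε)) f.val φ a b q =
          TopForm.topForm hN (A.erase i₀) (TopForm.bridgedChart a b i₀ G) (Function.update γ i₀ q)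
            (TopForm.bridgedFun a b a' c fbar) φ) := by
  have hcb : ∀ i, c i ≠ b := fun i h => hbS (h ▸ hcS i)
  refine ⟨TopForm.locus_updateRels_inter hab hba' hcS haS hbS hL hLmin,
    fun C hCL hC α => ⟨TopForm.bridgeParam_eq hab hba' hcS hbS hL hCL hC α, fun I => ?_⟩,
    TopForm.exists_minorFun_val_eq_bridgedFun hab hba' hcb fbar hpole,
    fun A i₀ hi₀ Ω G hG ht => ⟨TopForm.isResidueChart_bridgedChart hN hab hba' hcS haS hbS hL hLmin
      hi₀ hG ht, fun γ hγ _ q hq hq0 E _ _ _ U φ hU hφ hcontour => ?_⟩⟩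
  · rw [TopForm.rewriteMinor_mul_bridge hab]
  · exact TopForm.attachBridge_eq_topForm hi₀ hab hba' hcb hf hG ht hγ hq hq0 hU hφ
      fun s hs u hu => ⟨(hcontour s hs).1, (hcontour s hs).2.1, (hcontour s hs).2.2 u hu⟩
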